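/- For each $n\ge 1$ let $a_1,\dots,a_n$ and $b_1,\dots,b_n$ be positive real numbers (for instance the first $n$ terms of two fixed positive sequences; in general they may depend on $n$: $a_i=a_{n,i}$, $b_i=b_{n,i}$). Expand $$\phi_n(q)=\frac{(1-q^{a_1})(1-q^{a_2})\cdots(1-q^{a_n})}{(1-q^{b_1})(1-q^{b_2})\cdots(1-q^{b_n})}=\sum_k p_n(k)\,q^k$$ as a formal series in $q$ (the exponents $k$ are real in general, and integers if all $a_i,b_i$ are integers), and suppose that $p_n(k)\ge 0$ for all $n$ and $k$. Let $\xi_n$ be a random variable with $$P(\xi_n=k)=\frac{p_n(k)}{\sum_j p_n(j)}\qquad\text{for all }k .$$ Then $\xi_n$ has finite second moment and $$\sigma_n^2=\operatorname{Var}(\xi_n)=\frac1{12}\sum_{i=1}^n(a_i^2-b_i^2).$$ Moreover $(\xi_n-E(\xi_n))/\operatorname{Var}(\xi_n)^{1/2}$ converges in distribution to the standard normal distribution as $n\to\infty$ if and only if $$\sum_{k=2}^{\infty}B_{2k}\,\frac{t^{2k}}{2k\,(2k)!}\cdot\frac{\sum_{i=1}^n(a_i^{2k}-b_i^{2k})}{\left(\sum_{i=1}^n(a_i^2-b_i^2)\right)^k}\longrightarrow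 0\qquad(n\to\infty)$$ uniformly for $t$ in every bounded set of real numbers, where $B_j$ are the Bernoulli numbers. The latter condition includes that $\sum_{i=1}^n(a_i^2-b_i^2)\neq 0$ for all large $n$ and that, for every bounded set of $t$, the series converges on that set for all large $n$. -/

import Mathlib

open MeasureTheory ProbabilityTheory Filter Topology

/-- The quotient `∏ (1 - q ^ a i) / ∏ (1 - q ^ b i)` as a formal series in `q`. The numbers `a i`,
`b i` are arbitrary (positive) reals, so the exponents of the series are real numbers: it lives in
the field of Hahn series, where `HahnSeries.single c 1` is the monomial `q ^ c`. When all the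
`a i`, `b i` are integers this is the usual power series. -/
noncomputable def qQuotient {n : ℕ} (a b : Fin n → ℝ) : HahnSeries ℝ ℝ :=
  (∏ i, (1 - HahnSeries.single (a i) (1 : ℝ))) / (∏ i, (1 - HahnSeries.single (b i) (1 : ℝ)))

/-- The coefficient of `q ^ k` in `∏ (1 - q ^ a i) / ∏ (1 - q ^ b i)`. -/
noncomputable def qCoeff {n : ℕ} (a b : Fin n → ℝ) (k : ℝ) : ℝ :=
  (qQuotient a b).coeff k

/-- `∑ i, (a i ^ m - b i ^ m)`. -/
noncomputable def powerDiff {n : ℕ} (a b : Fin n → ℝ) (m : ℕ) : ℝ :=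
  ∑ i, (a i ^ m - b i ^ m)

/-- The `k`-th term of the Bernoulli number series. -/
noncomputable def bernoulliTerm {n : ℕ} (a b : Fin n → ℝ) (t : ℝ) (k : ℕ) : ℝ :=
  (bernoulli (2 * k) : ℝ) * (t ^ (2 * k) / ((2 * k : ℝ) * ((2 * k).factorial : ℝ)))
    * (powerDiff a b (2 * k) / powerDiff a b 2 ^ k)

/-- The Bernoulli number series, summed over all `k ≥ 2`, tends to `0` as `n → ∞`, uniformly for
`t` in any bounded set. This includes that, for all large `n`, the terms are defined (the
denominator is nonzero) and the series converges on the bounded set under consideration. -/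
def BernoulliSeriesTendstoZero (a b : (n : ℕ) → Fin n → ℝ) : Prop :=
  (∀ᶠ n in atTop, powerDiff (a n) (b n) 2 ≠ 0) ∧
  ∀ T : Set ℝ, Bornology.IsBounded T →
    (∀ᶠ n in atTop, ∀ t ∈ T, Summable fun k : ℕ => bernoulliTerm (a n) (b n) t (k + 2)) ∧
    TendstoUniformlyOn (fun (n : ℕ) (t : ℝ) => ∑' k : ℕ, bernoulliTerm (a n) (b n) t (k + 2))
      (fun _ => 0) atTop T

/-- The random variables `ξ n` are asymptotically normal: `(ξ n - E (ξ n)) / Var (ξ n) ^ (1 / 2)`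
converges in distribution to the standard normal distribution. -/
def AsymptoticallyNormal {Ω : ℕ → Type*} [∀ n, MeasurableSpace (Ω n)]
    (P : (n : ℕ) → Measure (Ω n)) [∀ n, IsProbabilityMeasure (P n)]
    (ξ : (n : ℕ) → Ω n → ℝ) : Prop :=
  TendstoInDistribution
    (fun n ω => (ξ n ω - ∫ ω', ξ n ω' ∂(P n)) / Real.sqrt (variance (ξ n) (P n)))
    atTop (id : ℝ → ℝ) P (gaussianReal 0 1)

/-! Evaluating the formal series at `q = exp z` with `z.re < 0` and letting `z` tend to the
imaginary axis (the coefficients are nonnegative and summable) turns the definition of `p_n` into an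
identity for the characteristic function `f` of `ξ - m`, `m = ∑ (a i - b i) / 2`: with `sinProd c s
= ∏ sin (c i s / 2) / c i` one has `f * sinProd b = sinProd a` (`charFun_mul_sinProd`). The
expansion of `f` at `0` gives mean and variance; Fatou's lemma supplies the finite second moment.

Positivity enters decisively through `|f| ≤ 1`. It gives `|sinProd a| ≤ |sinProd b|`, so every
positive zero of `sinProd b` is a zero of `sinProd a` of at least the same multiplicity. Hence
Euler's product reads `f s = ∏ (1 - s² / y²) ^ N y` over `y > 0` with natural exponents `N y`
(`netZeroCount`): `f` has only real zeros and no poles. By Euler's values of ζ(2k), `∑ N y / y ^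
(2k)` is a Bernoulli multiple of `D_{2k} = ∑ (a i ^ (2k) - b i ^ (2k))`; in particular `∑ N y / y² =
D / 24`, where `D = D_2`.

Both sides of the equivalence then say that the normalized zeros `y √D` escape to infinity
(`ZerosEscape`). The Bernoulli series is, up to signs, a sum of the positive quantities `(t² / D) ^
k / k * ∑ N y / y ^ (2k)`; it diverges once `|t|` exceeds some `y √D`, and is dominated by a small
geometric series when all of them are large. On the other side, below the zeros `log f s` equals
`-s² D / 24` up to an error comparable to `s⁴ ∑ N y / y⁴`, which has a strict sign. Gaussian
behaviour at a single point therefore forces this error to vanish, hence all zeros to escape, and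
escape gives Gaussian behaviour everywhere. -/

/-! ### Evaluation of Hahn series at `q = exp z`. -/

/-- The Hahn series `x` has nonnegative exponents only, and evaluates to `v` at `q = exp z`. -/
structure HahnSeries.HasEval (z : ℂ) (x : HahnSeries ℝ ℝ) (v : ℂ) : Prop where
  coeff_neg : ∀ k < 0, x.coeff k = 0
  hasSum : HasSum (fun k : ℝ => (x.coeff k : ℂ) * Complex.exp (k * z)) v

namespace HahnSeries.HasEval

variable {z : ℂ} {x y : HahnSeries ℝ ℝ} {v w : ℂ}

theorem single {c : ℝ} (hc : 0 ≤ c) : HasEval z (HahnSeries.single c 1) (Complex.exp (c * z)) := by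
  refine ⟨fun k hk => HahnSeries.coeff_single_of_ne (by linarith), ?_⟩
  convert hasSum_ite_eq c (Complex.exp (c * z)) using 2 with k
  by_cases h : k = c
  · simp [h]
  · simp [h, HahnSeries.coeff_single_of_ne h]

theorem one : HasEval z 1 1 := by
  simpa using single (z := z) le_rfl

theorem sub (hx : HasEval z x v) (hy : HasEval z y w) : HasEval z (x - y) (v - w) := by
  refine ⟨fun k hk => by simp [hx.coeff_neg k hk, hy.coeff_neg k hk], ?_⟩
  convert! hx.hasSum.sub hy.hasSum using 1
  funext k
  rw [HahnSeries.coeff_sub, Complex.ofReal_sub, sub_mul]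

/-- The double series converges absolutely, so it may be regrouped along the lines `i + j = k`; on
each line only the finitely many pairs of the Hahn antidiagonal contribute. -/
theorem mul (hx : HasEval z x v) (hy : HasEval z y w) : HasEval z (x * y) (v * w) := by
  constructor
  · intro k hk
    rw [HahnSeries.coeff_mul]
    refine Finset.sum_eq_zero fun ij hij => ?_
    have h := (Finset.mem_antidiagonal.1 hij).2.2
    rcases lt_or_ge ij.1 0 with h1 | h1
    · simp [hx.coeff_neg _ h1]
    · simp [hy.coeff_neg ij.2 (by linarith)]
  · have hs := summable_mul_of_summable_norm hx.hasSum.summable.norm hy.hasSum.summable.norm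
    have h := hx.hasSum.mul hy.hasSum hs
    rw [← (Equiv.sigmaFiberEquiv fun p : ℝ × ℝ => p.1 + p.2).hasSum_iff] at h
    refine h.sigma fun k => ?_
    have hterm : ∀ c : {p : ℝ × ℝ // p.1 + p.2 = k},
        ((fun p : ℝ × ℝ => (x.coeff p.1 : ℂ) * Complex.exp (p.1 * z) *
          ((y.coeff p.2 : ℂ) * Complex.exp (p.2 * z))) ∘
          (Equiv.sigmaFiberEquiv fun p : ℝ × ℝ => p.1 + p.2)) ⟨k, c⟩ =
        ((x.coeff c.1.1 * y.coeff c.1.2 : ℝ) : ℂ) * Complex.exp (k * z) := by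
      rintro ⟨⟨i, j⟩, hij⟩
      simp only [Function.comp, Equiv.sigmaFiberEquiv_apply]
      simp only at hij
      rw [← hij]
      push_cast
      rw [add_mul, Complex.exp_add]
      ring
    simp only [hterm]
    refine HasSum.mul_right _ ?_
    rw [Complex.hasSum_ofReal]
    rw [HahnSeries.coeff_mul]
    have := hasSum_subtype_iff_indicator (f := fun p : ℝ × ℝ => x.coeff p.1 * y.coeff p.2)
      (s := {p : ℝ × ℝ | p.1 + p.2 = k})
      (a := ∑ ij ∈ Finset.antidiagonal x.isPWO_support y.isPWO_support k,
        x.coeff ij.1 * y.coeff ij.2)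
    refine this.2 ?_
    have h2 : ∑ ij ∈ Finset.antidiagonal x.isPWO_support y.isPWO_support k,
        x.coeff ij.1 * y.coeff ij.2 =
        ∑ ij ∈ Finset.antidiagonal x.isPWO_support y.isPWO_support k,
        Set.indicator {p : ℝ × ℝ | p.1 + p.2 = k} (fun p => x.coeff p.1 * y.coeff p.2) ij := by
      refine Finset.sum_congr rfl fun ij hij => ?_
      rw [Set.indicator_of_mem]
      exact (Finset.mem_antidiagonal.1 hij).2.2
    rw [h2]
    refine hasSum_sum_of_ne_finset_zero fun p hp => ?_
    by_cases hk : p ∈ {p : ℝ × ℝ | p.1 + p.2 = k}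
    · rw [Set.indicator_of_mem hk]
      by_contra hne
      exact hp (Finset.mem_antidiagonal.2 ⟨left_ne_zero_of_mul hne, right_ne_zero_of_mul hne, hk⟩)
    · exact Set.indicator_of_notMem hk _

theorem prod {ι : Type*} (s : Finset ι) {x : ι → HahnSeries ℝ ℝ} {v : ι → ℂ}
    (h : ∀ i ∈ s, HasEval z (x i) (v i)) : HasEval z (∏ i ∈ s, x i) (∏ i ∈ s, v i) := by
  classical
  induction s using Finset.induction_on with
  | empty => simpa using one
  | insert i s hi ih =>
    rw [Finset.prod_insert hi, Finset.prod_insert hi]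
    exact (h i (by simp)).mul (ih fun j hj => h j (by simp [hj]))

/-- The inverse is the geometric power series transported along `m ↦ m * c`, which identifies its
coefficients. -/
theorem one_sub_single_inv {c : ℝ} (hc : 0 < c) (hz : z.re < 0) :
    HasEval z (1 - HahnSeries.single c (1 : ℝ))⁻¹ (1 - Complex.exp (c * z))⁻¹ := by
  let f : ℕ →+ ℝ := (AddMonoidHom.mulRight c).comp (Nat.castAddMonoidHom ℝ)
  have hfa : ∀ m, f m = m * c := fun m => rfl
  have hf : ∀ g g' : ℕ, f g ≤ f g' ↔ g ≤ g' := by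
    intro g g'
    rw [hfa, hfa, mul_le_mul_iff_left₀ hc, Nat.cast_le]
  have hfi : Function.Injective f := fun g g' h =>
    le_antisymm ((hf _ _).1 h.le) ((hf _ _).1 h.ge)
  let G : HahnSeries ℕ ℝ := HahnSeries.toPowerSeries.symm (PowerSeries.mk 1)
  have hG : G * (1 - HahnSeries.single 1 1) = 1 := by
    apply HahnSeries.toPowerSeries.injective
    rw [map_mul, map_sub, map_one]
    have h1 : HahnSeries.toPowerSeries (HahnSeries.single 1 (1 : ℝ)) = PowerSeries.X := by
      ext m
      rw [HahnSeries.coeff_toPowerSeries, PowerSeries.coeff_X, HahnSeries.coeff_single]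
      congr
    rw [h1]
    simp only [G, RingEquiv.apply_symm_apply]
    exact PowerSeries.mk_one_mul_one_sub_eq_one ℝ
  have hinv : (1 - HahnSeries.single c (1 : ℝ))⁻¹ = HahnSeries.embDomainRingHom f hfi hf G := by
    symm
    apply eq_inv_of_mul_eq_one_left
    have h2 := congrArg (HahnSeries.embDomainRingHom f hfi hf) hG
    rw [map_mul, map_sub, map_one] at h2
    have h3 : HahnSeries.embDomainRingHom f hfi hf (HahnSeries.single 1 (1 : ℝ)) =
        HahnSeries.single c 1 := by
      refine HahnSeries.embDomain_single.trans ?_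
      simp [hfa]
    rwa [h3] at h2
  have hcoeff : ∀ m : ℕ, (HahnSeries.embDomainRingHom f hfi hf G).coeff (f m) = 1 := by
    intro m
    refine (HahnSeries.embDomain_mk_coeff hfi hf).trans ?_
    simp [G]
  have hzero : ∀ k, k ∉ Set.range f → (HahnSeries.embDomainRingHom f hfi hf G).coeff k = 0 :=
    fun k hk => HahnSeries.embDomain_of_notMem_range hk
  rw [hinv]
  constructor
  · intro k hk
    refine hzero k ?_
    rintro ⟨m, rfl⟩
    rw [hfa] at hk
    have : 0 ≤ (m : ℝ) * c := by positivity
    linarith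
  · rw [← hfi.hasSum_iff]
    · have hn : ‖Complex.exp (c * z)‖ < 1 := by
        rw [Complex.norm_exp, Real.exp_lt_one_iff]
        simp only [Complex.mul_re, Complex.ofReal_re, Complex.ofReal_im, zero_mul, sub_zero]
        exact mul_neg_of_pos_of_neg hc hz
      convert! hasSum_geometric_of_norm_lt_one hn using 1
      funext m
      rw [Function.comp, hcoeff]
      rw [← Complex.exp_nat_mul, hfa]
      push_cast
      ring_nf
    · intro k hk
      rw [hzero k hk, Complex.ofReal_zero, zero_mul]

end HahnSeries.HasEval

theorem hasEval_qQuotient {n : ℕ} {a b : Fin n → ℝ} (ha : ∀ i, 0 < a i) (hb : ∀ i, 0 < b i)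
    {z : ℂ} (hz : z.re < 0) :
    HahnSeries.HasEval z (qQuotient a b)
      ((∏ i, (1 - Complex.exp (a i * z))) / ∏ i, (1 - Complex.exp (b i * z))) := by
  rw [qQuotient, div_eq_mul_inv, div_eq_mul_inv, ← Finset.prod_inv_distrib,
    ← Finset.prod_inv_distrib]
  exact (HahnSeries.HasEval.prod _ fun i _ => .sub .one (.single (ha i).le)).mul
    (HahnSeries.HasEval.prod _ fun i _ => .one_sub_single_inv (hb i) hz)

/-! ### Summability of the coefficients and passage to the imaginary axis. -/

section Summability

variable {n : ℕ} {a b : Fin n → ℝ}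

theorem qCoeff_of_neg (ha : ∀ i, 0 < a i) (hb : ∀ i, 0 < b i) {k : ℝ} (hk : k < 0) :
    qCoeff a b k = 0 :=
  (hasEval_qQuotient ha hb (z := -1) (by simp)).coeff_neg k hk

theorem hasSum_qCoeff_mul_exp (ha : ∀ i, 0 < a i) (hb : ∀ i, 0 < b i) {x : ℝ} (hx : 0 < x) :
    HasSum (fun k => qCoeff a b k * Real.exp (-(k * x)))
      ((∏ i, (1 - Real.exp (-(a i * x)))) / ∏ i, (1 - Real.exp (-(b i * x)))) := by
  have h := (hasEval_qQuotient ha hb (z := ((-x : ℝ) : ℂ)) (by simpa using hx)).hasSum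
  rw [← Complex.hasSum_ofReal]
  push_cast at h ⊢
  simpa only [mul_neg, qCoeff] using h

theorem tendsto_one_sub_exp_neg_mul_div (c : ℝ) :
    Tendsto (fun x => (1 - Real.exp (-(c * x))) / x) (𝓝[>] 0) (𝓝 c) := by
  have h : HasDerivAt (fun x => 1 - Real.exp (-(c * x))) c 0 := by
    have := (((hasDerivAt_id (0 : ℝ)).const_mul c).neg.exp).const_sub 1
    simpa using this
  have := h.tendsto_slope.mono_left (nhdsWithin_mono (0 : ℝ) (fun x (hx : 0 < x) => hx.ne'))
  refine this.congr fun x => ?_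
  simp [slope_def_field]

theorem tendsto_prod_div_prod (hb : ∀ i, 0 < b i) :
    Tendsto (fun x => (∏ i, (1 - Real.exp (-(a i * x)))) / ∏ i, (1 - Real.exp (-(b i * x))))
      (𝓝[>] 0) (𝓝 ((∏ i, a i) / ∏ i, b i)) := by
  have h1 := tendsto_finsetProd Finset.univ
    fun i (_ : i ∈ Finset.univ) => tendsto_one_sub_exp_neg_mul_div (a i)
  have h2 := tendsto_finsetProd Finset.univ
    fun i (_ : i ∈ Finset.univ) => tendsto_one_sub_exp_neg_mul_div (b i)
  refine (h1.div h2 (Finset.prod_ne_zero_iff.2 fun i _ => (hb i).ne')).congr' ?_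
  filter_upwards [self_mem_nhdsWithin] with x hx
  have hx' : x ≠ 0 := ne_of_gt hx
  -- Numerator and denominator have the same number of factors, so the powers of `x` cancel.
  rw [Pi.div_apply, Finset.prod_div_distrib, Finset.prod_div_distrib, Finset.prod_const,
    div_div_div_cancel_right₀ (pow_ne_zero _ hx')]

/-- For nonnegative coefficients, a finite partial sum is the limit as `x → 0+` of partial sums
bounded by the full product, whose limit is finite. -/
theorem summable_qCoeff (ha : ∀ i, 0 < a i) (hb : ∀ i, 0 < b i)
    (hp : ∀ k, 0 ≤ qCoeff a b k) : Summable (qCoeff a b) := by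
  refine summable_of_sum_le (c := (∏ i, a i) / ∏ i, b i) hp fun u => ?_
  have h1 : Tendsto (fun x : ℝ => ∑ k ∈ u, qCoeff a b k * Real.exp (-(k * x))) (𝓝[>] 0)
      (𝓝 (∑ k ∈ u, qCoeff a b k)) := by
    have : Continuous fun x : ℝ => ∑ k ∈ u, qCoeff a b k * Real.exp (-(k * x)) := by fun_prop
    simpa using (this.tendsto 0).mono_left nhdsWithin_le_nhds
  refine le_of_tendsto_of_tendsto h1 (tendsto_prod_div_prod hb) ?_
  filter_upwards [self_mem_nhdsWithin] with x hx
  exact sum_le_hasSum u (fun k _ => mul_nonneg (hp k) (Real.exp_pos _).le)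
    (hasSum_qCoeff_mul_exp ha hb hx)

theorem tendsto_tsum_qCoeff_mul_cexp (ha : ∀ i, 0 < a i) (hb : ∀ i, 0 < b i)
    (hp : ∀ k, 0 ≤ qCoeff a b k) (s : ℝ) :
    Tendsto (fun x : ℝ => ∑' k : ℝ, (qCoeff a b k : ℂ) * Complex.exp (k * (-x + s * Complex.I)))
      (𝓝[>] 0) (𝓝 (∑' k : ℝ, (qCoeff a b k : ℂ) * Complex.exp (k * (s * Complex.I)))) := by
  refine tendsto_tsum_of_dominated_convergence (summable_qCoeff ha hb hp) (fun k => ?_) ?_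
  · have : Continuous fun x : ℝ =>
        (qCoeff a b k : ℂ) * Complex.exp (k * (-x + s * Complex.I)) := by fun_prop
    simpa using (this.tendsto 0).mono_left nhdsWithin_le_nhds
  · filter_upwards [self_mem_nhdsWithin] with x hx k
    rcases lt_or_ge k 0 with hk | hk
    · simp [qCoeff_of_neg ha hb hk]
    · rw [norm_mul, Complex.norm_real, Real.norm_of_nonneg (hp k), Complex.norm_exp]
      refine mul_le_of_le_one_right (hp k) (Real.exp_le_one_iff.2 ?_)
      have : 0 ≤ k * x := mul_nonneg hk (le_of_lt hx)
      simpa using this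

/-- The product form avoids dividing by factors that vanish for some `s` on the imaginary axis. -/
theorem tsum_qCoeff_mul_cexp (ha : ∀ i, 0 < a i) (hb : ∀ i, 0 < b i)
    (hp : ∀ k, 0 ≤ qCoeff a b k) (s : ℝ) :
    (∑' k : ℝ, (qCoeff a b k : ℂ) * Complex.exp (k * (s * Complex.I))) *
      ∏ i, (1 - Complex.exp (b i * (s * Complex.I))) =
      ∏ i, (1 - Complex.exp (a i * (s * Complex.I))) := by
  have hlim (c : Fin n → ℝ) : Tendsto (fun x : ℝ =>
      ∏ i, (1 - Complex.exp (c i * (-x + s * Complex.I)))) (𝓝[>] 0)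
      (𝓝 (∏ i, (1 - Complex.exp (c i * (s * Complex.I))))) := by
    have : Continuous fun x : ℝ => ∏ i, (1 - Complex.exp (c i * (-x + s * Complex.I))) := by
      fun_prop
    simpa using (this.tendsto 0).mono_left nhdsWithin_le_nhds
  refine tendsto_nhds_unique
    ((tendsto_tsum_qCoeff_mul_cexp ha hb hp s).mul (hlim b)) ((hlim a).congr' ?_)
  filter_upwards [self_mem_nhdsWithin] with x hx
  have hz : (-(x : ℂ) + s * Complex.I).re < 0 := by simpa using hx
  have h := (hasEval_qQuotient ha hb hz).hasSum.tsum_eq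
  rw [show (∑' k : ℝ, (qCoeff a b k : ℂ) * Complex.exp (k * (-x + s * Complex.I))) = _ from h,
    div_mul_cancel₀]
  refine Finset.prod_ne_zero_iff.2 fun i _ => sub_ne_zero.2 fun h1 => ?_
  have h2 := congrArg norm h1
  rw [norm_one, Complex.norm_exp] at h2
  have h3 : ((b i : ℂ) * (-(x : ℂ) + s * Complex.I)).re < 0 := by
    simpa using mul_pos (hb i) hx
  have := Real.exp_lt_one_iff.2 h3
  linarith

theorem tsum_qCoeff (ha : ∀ i, 0 < a i) (hb : ∀ i, 0 < b i)
    (hp : ∀ k, 0 ≤ qCoeff a b k) : ∑' k, qCoeff a b k = (∏ i, a i) / ∏ i, b i := by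
  have h := tendsto_tsum_qCoeff_mul_cexp ha hb hp 0
  simp only [Complex.ofReal_zero, zero_mul, add_zero, mul_zero, Complex.exp_zero, mul_one] at h
  rw [← Complex.ofReal_tsum] at h
  have h2 := (Complex.continuous_re.tendsto _).comp h
  refine tendsto_nhds_unique (h2.congr' ?_) (tendsto_prod_div_prod hb)
  filter_upwards [self_mem_nhdsWithin] with x hx
  rw [← (hasSum_qCoeff_mul_exp ha hb hx).tsum_eq, ← Complex.ofReal_re (∑' k, _),
    Complex.ofReal_tsum]
  simp

end Summability

/-! ### The characteristic function and sine products. -/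

/-- The point masses add up to `1`, so the measure is carried by their countable support. -/
theorem integral_eq_tsum_of_hasSum_one {ν : Measure ℝ} [IsProbabilityMeasure ν] {w : ℝ → ℝ}
    (hw : ∀ k, ν.real {k} = w k) (hsum : HasSum w 1) {g : ℝ → ℂ} (hg : Integrable g ν) :
    ∫ x, g x ∂ν = ∑' k, (w k : ℂ) * g k := by
  have hC : (Function.support w).Countable := hsum.summable.countable_support
  have h1 : ν.real (Function.support w) = 1 := by
    have h := setIntegral_countable (μ := ν) (fun _ : ℝ => (1 : ℝ)) hC (integrable_const _).integrableOn
    simp only [setIntegral_const, smul_eq_mul, mul_one, hw] at h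
    rw [h, tsum_subtype_eq_of_support_subset subset_rfl, hsum.tsum_eq]
  have h2 : ν (Function.support w)ᶜ = 0 := by
    rw [prob_compl_eq_zero_iff hC.measurableSet]
    rwa [measureReal_def, ENNReal.toReal_eq_one_iff] at h1
  have h3 : ∫ x in Function.support w, g x ∂ν = ∫ x, g x ∂ν := by
    rw [Measure.restrict_eq_self_of_ae_mem]
    exact h2
  rw [← h3, setIntegral_countable g hC hg.integrableOn]
  simp only [hw, Complex.real_smul]
  rw [tsum_subtype_eq_of_support_subset (f := fun k => (w k : ℂ) * g k)]
  intro k hk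
  simp only [Function.mem_support] at hk ⊢
  exact fun h => hk (by simp [h])

theorem prod_one_sub_cexp {n : ℕ} (c : Fin n → ℝ) (s : ℝ) :
    ∏ i, (1 - Complex.exp (c i * (s * Complex.I))) =
      Complex.exp ((∑ i, c i : ℝ) * (s / 2 * Complex.I)) * (-2 * Complex.I) ^ n *
        ((∏ i, Real.sin (c i * s / 2) : ℝ) : ℂ) := by
  have h : ∀ i, 1 - Complex.exp (c i * (s * Complex.I)) =
      Complex.exp (c i * (s / 2 * Complex.I)) * (-2 * Complex.I) * Complex.sin (c i * s / 2) := by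
    intro i
    have h1 : Complex.exp (c i * (s * Complex.I)) =
        Complex.exp (c i * (s / 2 * Complex.I)) * Complex.exp (c i * (s / 2 * Complex.I)) := by
      rw [← Complex.exp_add]
      ring_nf
    have h2 : Complex.exp (c i * (s / 2 * Complex.I)) * Complex.exp (-(c i * (s / 2 * Complex.I))) =
        1 := by
      rw [← Complex.exp_add, add_neg_cancel, Complex.exp_zero]
    rw [Complex.sin, show (c i * s / 2 : ℂ) * Complex.I = c i * (s / 2 * Complex.I) by ring,
      show -(c i * s / 2 : ℂ) * Complex.I = -(c i * (s / 2 * Complex.I)) by ring, h1]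
    linear_combination (-1 : ℂ) * h2 + (Complex.exp (c i * (s / 2 * Complex.I)) *
      Complex.exp (-(c i * (s / 2 * Complex.I))) - Complex.exp (c i * (s / 2 * Complex.I)) ^ 2) *
      Complex.I_sq
  simp only [h, Finset.prod_mul_distrib, Finset.prod_const, Finset.card_univ, Fintype.card_fin]
  rw [← Complex.exp_sum]
  push_cast
  rw [Finset.sum_mul, mul_pow]

/-- `∏ i, sin (c i * s / 2) / c i`. -/
noncomputable def sinProd {n : ℕ} (c : Fin n → ℝ) (s : ℝ) : ℝ :=
  ∏ i, Real.sin (c i * s / 2) / c i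

theorem charFun_map_sub_const {Ω : Type*} [MeasurableSpace Ω] {P : Measure Ω} {ξ : Ω → ℝ}
    (hξ : AEMeasurable ξ P) (m s : ℝ) :
    charFun (P.map fun ω => ξ ω - m) s =
      charFun (P.map ξ) s * Complex.exp (-(m * (s * Complex.I))) := by
  rw [charFun_apply_real, charFun_apply_real, integral_map (by fun_prop) (by fun_prop),
    integral_map hξ (by fun_prop), ← integral_mul_const]
  refine integral_congr_ae (Eventually.of_forall fun ω => ?_)
  simp only
  rw [← Complex.exp_add]
  push_cast
  ring_nf

/-- Writing `1 - exp (iθ) = -2i exp (iθ/2) sin (θ/2)`, the phases leave exactly `exp (i m s)`,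
removed by centering, and the total mass `∏ a / ∏ b` is absorbed by the divisors `c i` in `sinProd`.
-/
theorem charFun_mul_sinProd {n : ℕ} {a b : Fin n → ℝ} (ha : ∀ i, 0 < a i) (hb : ∀ i, 0 < b i)
    (hp : ∀ k, 0 ≤ qCoeff a b k) {Ω : Type*} [MeasurableSpace Ω] {P : Measure Ω}
    [IsProbabilityMeasure P] {ξ : Ω → ℝ} (hξ : AEMeasurable ξ P)
    (hlaw : ∀ k, P.real {ω | ξ ω = k} = qCoeff a b k / ∑' j, qCoeff a b j) (s : ℝ) :
    charFun (P.map fun ω => ξ ω - (∑ i, (a i - b i)) / 2) s * sinProd b s = sinProd a s := by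
  have hA : 0 < ∏ i, a i := Finset.prod_pos fun i _ => ha i
  have hB : 0 < ∏ i, b i := Finset.prod_pos fun i _ => hb i
  set m := (∑ i, (a i - b i)) / 2 with hmdef
  set S := ∑' j, qCoeff a b j with hS
  have hSe : S = (∏ i, a i) / ∏ i, b i := tsum_qCoeff ha hb hp
  have hS0 : S ≠ 0 := by rw [hSe]; positivity
  have : IsProbabilityMeasure (P.map ξ) := Measure.isProbabilityMeasure_map hξ
  have hw : ∀ k, (P.map ξ).real {k} = qCoeff a b k / S := by
    intro k
    rw [← hlaw, measureReal_def, Measure.map_apply_of_aemeasurable hξ (measurableSet_singleton k)]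
    rfl
  have hsum : HasSum (fun k => qCoeff a b k / S) 1 := by
    have := (summable_qCoeff ha hb hp).hasSum.div_const S
    rwa [← hS, div_self hS0] at this
  have hchar : charFun (P.map ξ) s * S =
      ∑' k : ℝ, (qCoeff a b k : ℂ) * Complex.exp (k * (s * Complex.I)) := by
    rw [charFun_apply_real, integral_eq_tsum_of_hasSum_one hw hsum, ← tsum_mul_right]
    · refine tsum_congr fun k => ?_
      have : (S : ℂ) ≠ 0 := by exact_mod_cast hS0
      push_cast
      field_simp
    · refine (integrable_const (1 : ℝ)).mono' (by fun_prop) (Eventually.of_forall fun x => ?_)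
      rw [← Complex.ofReal_mul, Complex.norm_exp_ofReal_mul_I]
  have key := tsum_qCoeff_mul_cexp ha hb hp s
  rw [← hchar, prod_one_sub_cexp, prod_one_sub_cexp] at key
  rw [charFun_map_sub_const hξ]
  have hexp : Complex.exp ((∑ i, a i : ℝ) * (s / 2 * Complex.I)) =
      Complex.exp ((∑ i, b i : ℝ) * (s / 2 * Complex.I)) *
        Complex.exp (m * (s * Complex.I)) := by
    rw [← Complex.exp_add, hmdef, Finset.sum_sub_distrib]
    push_cast
    ring_nf
  have hm : Complex.exp (m * (s * Complex.I)) *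
      Complex.exp (-(m * (s * Complex.I))) = 1 := by
    rw [← Complex.exp_add, add_neg_cancel, Complex.exp_zero]
  have h2I : (-2 * Complex.I) ^ n ≠ 0 := pow_ne_zero _ (by simp)
  have key2 : charFun (P.map ξ) s * S * ((∏ i, Real.sin (b i * s / 2) : ℝ) : ℂ) =
      Complex.exp (m * (s * Complex.I)) *
        ((∏ i, Real.sin (a i * s / 2) : ℝ) : ℂ) := by
    apply mul_left_cancel₀ (mul_ne_zero (Complex.exp_ne_zero
      ((∑ i, b i : ℝ) * (s / 2 * Complex.I))) h2I)
    rw [hexp] at key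
    linear_combination key
  have hSc : (S : ℂ) * ((∏ i, b i : ℝ) : ℂ) = ((∏ i, a i : ℝ) : ℂ) := by
    rw [← Complex.ofReal_mul, hSe, div_mul_cancel₀ _ hB.ne']
  have hAc : ((∏ i, a i : ℝ) : ℂ) ≠ 0 := by exact_mod_cast hA.ne'
  have hBc : ((∏ i, b i : ℝ) : ℂ) ≠ 0 := by exact_mod_cast hB.ne'
  rw [sinProd, sinProd, Finset.prod_div_distrib, Finset.prod_div_distrib, 
    Complex.ofReal_div (∏ i, Real.sin (b i * s / 2)), Complex.ofReal_div (∏ i, Real.sin (a i * s / 2)), ← mul_div_assoc, div_eq_div_iff hBc hAc, ← hSc]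
  linear_combination ((∏ i, b i : ℝ) : ℂ) *
    Complex.exp (-(m * (s * Complex.I))) * key2 +
    ((∏ i, b i : ℝ) : ℂ) * ((∏ i, Real.sin (a i * s / 2) : ℝ) : ℂ) * hm

/-! ### Second-order expansion at the origin. -/

section Expansion

/-- `u s = 1 - α * s ^ 2 + o (s ^ 2)` as `s → 0`. -/
def HasQuadraticExpansion (u : ℝ → ℝ) (α : ℝ) : Prop :=
  Tendsto (fun s => (1 - u s) / s ^ 2) (𝓝[≠] 0) (𝓝 α)

namespace HasQuadraticExpansion

variable {u v : ℝ → ℝ} {α β : ℝ}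

theorem tendsto_one (h : HasQuadraticExpansion u α) : Tendsto u (𝓝[≠] 0) (𝓝 1) := by
  have h2 : Tendsto (fun s : ℝ => s ^ 2) (𝓝[≠] 0) (𝓝 0) := by
    have : Tendsto (fun s : ℝ => s ^ 2) (𝓝 0) (𝓝 (0 ^ 2)) := (continuous_pow 2).tendsto 0
    simpa using this.mono_left nhdsWithin_le_nhds
  have h3 := (Filter.Tendsto.mul h h2).const_sub 1
  simp only [mul_zero, sub_zero] at h3
  refine h3.congr' ?_
  filter_upwards [self_mem_nhdsWithin] with s hs
  have : s ≠ 0 := hs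
  field_simp
  ring

theorem one : HasQuadraticExpansion (fun _ => 1) 0 := by
  simp [HasQuadraticExpansion]

theorem mul (hu : HasQuadraticExpansion u α) (hv : HasQuadraticExpansion v β) :
    HasQuadraticExpansion (fun s => u s * v s) (α + β) := by
  have h := Filter.Tendsto.add hu (Filter.Tendsto.mul hu.tendsto_one hv)
  rw [one_mul] at h
  refine h.congr fun s => ?_
  ring

theorem div (hu : HasQuadraticExpansion u α) (hv : HasQuadraticExpansion v β) :
    HasQuadraticExpansion (fun s => u s / v s) (α - β) := by
  have h := (Filter.Tendsto.sub hu hv).div hv.tendsto_one one_ne_zero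
  rw [div_one] at h
  refine h.congr' ?_
  filter_upwards [hv.tendsto_one.eventually_ne one_ne_zero] with s hs
  simp only [Pi.div_apply]
  rw [← sub_div, div_right_comm]
  congr 1
  field_simp
  ring

theorem prod {ι : Type*} (t : Finset ι) {u : ι → ℝ → ℝ} {α : ι → ℝ}
    (h : ∀ i ∈ t, HasQuadraticExpansion (u i) (α i)) :
    HasQuadraticExpansion (fun s => ∏ i ∈ t, u i s) (∑ i ∈ t, α i) := by
  classical
  induction t using Finset.induction_on with
  | empty => simpa using one
  | insert i t hi ih =>
    simp only [Finset.prod_insert hi, Finset.sum_insert hi]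
    exact (h i (by simp)).mul (ih fun j hj => h j (by simp [hj]))

theorem congr (hu : HasQuadraticExpansion u α) (h : ∀ᶠ s in 𝓝[≠] 0, u s = v s) :
    HasQuadraticExpansion v α :=
  Filter.Tendsto.congr' (h.mono fun s hs => by rw [hs]) hu

end HasQuadraticExpansion

theorem hasQuadraticExpansion_sin_div {c : ℝ} (hc : 0 < c) :
    HasQuadraticExpansion (fun s => Real.sin (c * s / 2) / (c * s / 2)) (c ^ 2 / 24) := by
  unfold HasQuadraticExpansion
  have hlim : Tendsto (fun s : ℝ => |c * s / 2| ^ 2 * (1 / 100) * (c ^ 2 / 4)) (𝓝[≠] 0) (𝓝 0) := by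
    have : Continuous fun s : ℝ => |c * s / 2| ^ 2 * (1 / 100) * (c ^ 2 / 4) := by fun_prop
    simpa using (this.tendsto 0).mono_left nhdsWithin_le_nhds
  rw [tendsto_iff_dist_tendsto_zero]
  refine squeeze_zero' (Eventually.of_forall fun _ => dist_nonneg) ?_ hlim
  have hsmall : ∀ᶠ s : ℝ in 𝓝[≠] 0, |c * s / 2| < 1 := by
    have : Continuous fun s : ℝ => |c * s / 2| := by fun_prop
    exact ((this.tendsto 0).mono_left nhdsWithin_le_nhds).eventually_lt_const (by simp)
  filter_upwards [self_mem_nhdsWithin, hsmall] with s hs hs1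
  have hs0 : s ≠ 0 := hs
  set x := c * s / 2 with hx
  have hx0 : x ≠ 0 := by positivity
  have hb := Real.sin_bound hs1.le
  have hs2 : s ^ 2 = 4 * x ^ 2 / c ^ 2 := by rw [hx]; field_simp; ring
  rw [Real.dist_eq, hs2]
  have h3 : (1 - Real.sin x / x) / (4 * x ^ 2 / c ^ 2) - c ^ 2 / 24 =
      -(Real.sin x - (x - x ^ 3 / 6)) / x ^ 3 * (c ^ 2 / 4) := by
    field_simp
    ring
  rw [h3, abs_mul, abs_div, abs_neg, abs_of_nonneg (by positivity : 0 ≤ c ^ 2 / 4), abs_pow]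
  gcongr
  rw [div_le_iff₀ (by positivity)]
  calc _ ≤ _ := hb
    _ = _ := by ring

theorem hasQuadraticExpansion_sinProd_div {n : ℕ} {a b : Fin n → ℝ} (ha : ∀ i, 0 < a i)
    (hb : ∀ i, 0 < b i) :
    HasQuadraticExpansion (fun s => sinProd a s / sinProd b s) (powerDiff a b 2 / 24) := by
  have h := (HasQuadraticExpansion.prod Finset.univ fun i _ => hasQuadraticExpansion_sin_div (ha i)).div
    (HasQuadraticExpansion.prod Finset.univ fun i _ => hasQuadraticExpansion_sin_div (hb i))
  rw [← Finset.sum_div, ← Finset.sum_div, ← sub_div, ← Finset.sum_sub_distrib] at h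
  refine h.congr ?_
  filter_upwards [self_mem_nhdsWithin] with s hs
  have hs0 : s ≠ 0 := hs
  have hc (c : Fin n → ℝ) : ∏ i, Real.sin (c i * s / 2) / (c i * s / 2) =
      sinProd c s / (s / 2) ^ n := by
    rw [sinProd, ← Fin.prod_const n (s / 2), ← Finset.prod_div_distrib]
    exact Finset.prod_congr rfl fun i _ => by rw [div_div, mul_div_assoc]
  rw [hc, hc, div_div_div_cancel_right₀ (by positivity)]

theorem sinProd_ne_zero_eventually {n : ℕ} {b : Fin n → ℝ} (hb : ∀ i, 0 < b i) :
    ∀ᶠ s in 𝓝[≠] 0, sinProd b s ≠ 0 := by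
  have h := (HasQuadraticExpansion.prod Finset.univ
    fun i _ => hasQuadraticExpansion_sin_div (hb i)).tendsto_one.eventually_ne one_ne_zero
  filter_upwards [h] with s hs
  refine Finset.prod_ne_zero_iff.2 fun i _ => ?_
  have := Finset.prod_ne_zero_iff.1 hs i (Finset.mem_univ i)
  exact div_ne_zero (div_ne_zero_iff.1 this).1 (hb i).ne'

theorem charFun_eventually_eq {ν : Measure ℝ} {n : ℕ} {a b : Fin n → ℝ} (hb : ∀ i, 0 < b i)
    (H : ∀ s : ℝ, charFun ν s * sinProd b s = sinProd a s) :
    ∀ᶠ s in 𝓝[≠] 0, charFun ν s = ((sinProd a s / sinProd b s : ℝ) : ℂ) := by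
  filter_upwards [sinProd_ne_zero_eventually hb] with s hs
  rw [Complex.ofReal_div, ← H, mul_div_cancel_right₀]
  exact_mod_cast hs

end Expansion

/-! ### Moments from the characteristic function. -/

section Moments

variable {ν : Measure ℝ} [IsProbabilityMeasure ν]

theorem charFun_re_eq_integral_cos (s : ℝ) : (charFun ν s).re = ∫ x, Real.cos (s * x) ∂ν := by
  have hi : Integrable (fun x : ℝ => Complex.exp (s * x * Complex.I)) ν :=
    (integrable_const (1 : ℝ)).mono' (by fun_prop) (Eventually.of_forall fun x => by
      rw [← Complex.ofReal_mul, Complex.norm_exp_ofReal_mul_I])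
  rw [charFun_apply_real, ← RCLike.re_eq_complex_re, ← integral_re hi]
  refine integral_congr_ae (Eventually.of_forall fun x => ?_)
  simp only [RCLike.re_eq_complex_re]
  rw [← Complex.ofReal_mul, Complex.exp_ofReal_mul_I_re]

theorem charFun_im_eq_integral_sin (s : ℝ) : (charFun ν s).im = ∫ x, Real.sin (s * x) ∂ν := by
  have hi : Integrable (fun x : ℝ => Complex.exp (s * x * Complex.I)) ν :=
    (integrable_const (1 : ℝ)).mono' (by fun_prop) (Eventually.of_forall fun x => by
      rw [← Complex.ofReal_mul, Complex.norm_exp_ofReal_mul_I])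
  rw [charFun_apply_real, ← RCLike.im_eq_complex_im, ← integral_im hi]
  refine integral_congr_ae (Eventually.of_forall fun x => ?_)
  simp only [RCLike.im_eq_complex_im]
  rw [← Complex.ofReal_mul, Complex.exp_ofReal_mul_I_im]

theorem tendsto_two_mul_one_sub_cos_div (x : ℝ) :
    Tendsto (fun s => 2 * (1 - Real.cos (s * x)) / s ^ 2) (𝓝[≠] 0) (𝓝 (x ^ 2)) := by
  have h : HasDerivAt (fun s => Real.sin (s * x / 2)) (x / 2) 0 := by
    have := (((hasDerivAt_id (0 : ℝ)).mul_const x).div_const 2).sin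
    simpa using this
  have h2 := (h.tendsto_slope.pow 2).const_mul 4
  rw [show 4 * (x / 2) ^ 2 = x ^ 2 by ring] at h2
  refine h2.congr fun s => ?_
  rw [slope_def_field, show s * x = 2 * (s * x / 2) by ring, Real.cos_two_mul,
    show 2 * (s * x / 2) / 2 = s * x / 2 by ring, Real.cos_sq']
  simp
  ring

theorem two_mul_one_sub_cos_div_le (s x : ℝ) : 2 * (1 - Real.cos (s * x)) / s ^ 2 ≤ x ^ 2 := by
  rcases eq_or_ne s 0 with rfl | hs
  · simp [sq_nonneg]
  · rw [div_le_iff₀ (by positivity)]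
    have := Real.one_sub_sq_div_two_le_cos (x := s * x)
    nlinarith

variable {α : ℝ}

theorem integral_two_mul_one_sub_cos_div (s : ℝ) :
    ∫ x, 2 * (1 - Real.cos (s * x)) / s ^ 2 ∂ν = 2 * ((1 - (charFun ν s).re) / s ^ 2) := by
  have hc : Integrable (fun x => Real.cos (s * x)) ν :=
    (integrable_const (1 : ℝ)).mono' (by fun_prop)
      (Eventually.of_forall fun x => Real.abs_cos_le_one _)
  rw [charFun_re_eq_integral_cos, integral_div, integral_const_mul,
    integral_sub (integrable_const _) hc]
  simp
  ring

/-- Fatou's lemma along `s = 1 / (n + 1)`: the nonnegative functions `2 (1 - cos (s x)) / s²` tend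
to `x²`, and their integrals converge to a finite limit. -/
theorem memLp_two_of_charFun_re
    (h : HasQuadraticExpansion (fun s => (charFun ν s).re) α) : MemLp id 2 ν := by
  have hs : Tendsto (fun n : ℕ => 1 / ((n : ℝ) + 1)) atTop (𝓝[≠] 0) :=
    tendsto_nhdsWithin_iff.2 ⟨tendsto_one_div_add_atTop_nhds_zero_nat,
      Eventually.of_forall fun n => by simp; positivity⟩
  refine (memLp_two_iff_integrable_sq aestronglyMeasurable_id).2 ⟨by fun_prop, ?_⟩
  rw [hasFiniteIntegral_iff_ofReal (Eventually.of_forall fun x => sq_nonneg _)]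
  have hF := lintegral_liminf_le (μ := ν) (u := atTop) (f := fun (n : ℕ) (x : ℝ) =>
    ENNReal.ofReal (2 * (1 - Real.cos (1 / ((n : ℝ) + 1) * x)) / (1 / ((n : ℝ) + 1)) ^ 2))
    (fun n => by fun_prop)
  have h1 : ∀ x : ℝ, liminf (fun n : ℕ => ENNReal.ofReal
      (2 * (1 - Real.cos (1 / ((n : ℝ) + 1) * x)) / (1 / ((n : ℝ) + 1)) ^ 2)) atTop =
      ENNReal.ofReal (id x ^ 2) := fun x =>
    (ENNReal.tendsto_ofReal ((tendsto_two_mul_one_sub_cos_div x).comp hs)).liminf_eq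
  simp only [h1] at hF
  refine hF.trans_lt ?_
  have h2 : ∀ n : ℕ, ∫⁻ x, ENNReal.ofReal
      (2 * (1 - Real.cos (1 / ((n : ℝ) + 1) * x)) / (1 / ((n : ℝ) + 1)) ^ 2) ∂ν =
      ENNReal.ofReal (2 * ((1 - (charFun ν (1 / ((n : ℝ) + 1))).re) / (1 / ((n : ℝ) + 1)) ^ 2)) := by
    intro n
    have hnn : ∀ x, 0 ≤ 2 * (1 - Real.cos (1 / ((n : ℝ) + 1) * x)) / (1 / ((n : ℝ) + 1)) ^ 2 :=
      fun x => div_nonneg (mul_nonneg zero_le_two (sub_nonneg.2 (Real.cos_le_one _))) (sq_nonneg _)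
    rw [← integral_two_mul_one_sub_cos_div, ofReal_integral_eq_lintegral_ofReal _
      (Eventually.of_forall hnn)]
    have hc : Integrable (fun x => Real.cos (1 / ((n : ℝ) + 1) * x)) ν :=
      (integrable_const (1 : ℝ)).mono' (by fun_prop)
        (Eventually.of_forall fun x => Real.abs_cos_le_one _)
    exact (((integrable_const _).sub hc).const_mul 2).div_const _
  simp only [h2]
  have h3 : Tendsto (fun n : ℕ => ENNReal.ofReal
      (2 * ((1 - (charFun ν (1 / ((n : ℝ) + 1))).re) / (1 / ((n : ℝ) + 1)) ^ 2))) atTop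
      (𝓝 (ENNReal.ofReal (2 * α))) :=
    ENNReal.tendsto_ofReal ((Filter.Tendsto.comp h hs).const_mul 2)
  rw [h3.liminf_eq]
  exact ENNReal.ofReal_lt_top

theorem integral_sq_of_charFun_re
    (h : HasQuadraticExpansion (fun s => (charFun ν s).re) α) : ∫ x, x ^ 2 ∂ν = 2 * α := by
  have hL := (memLp_two_of_charFun_re h).integrable_sq
  refine tendsto_nhds_unique (f := fun s => ∫ x, 2 * (1 - Real.cos (s * x)) / s ^ 2 ∂ν)
    (l := 𝓝[≠] 0) ?_ ?_
  · refine tendsto_integral_filter_of_dominated_convergence (fun x => x ^ 2)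
      (Eventually.of_forall fun s => by fun_prop) (Eventually.of_forall fun s =>
        Eventually.of_forall fun x => ?_) hL
      (Eventually.of_forall tendsto_two_mul_one_sub_cos_div)
    rw [Real.norm_of_nonneg
      (div_nonneg (mul_nonneg zero_le_two (sub_nonneg.2 (Real.cos_le_one _))) (sq_nonneg _))]
    exact two_mul_one_sub_cos_div_le s x
  · simp only [integral_two_mul_one_sub_cos_div]
    exact Filter.Tendsto.const_mul 2 h

theorem integral_eq_zero_of_charFun_im (hL : MemLp id 2 ν)
    (h : ∀ᶠ s in 𝓝[≠] 0, (charFun ν s).im = 0) : ∫ x, x ∂ν = 0 := by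
  have hi : Integrable (fun x : ℝ => x) ν := hL.integrable one_le_two
  refine tendsto_nhds_unique (f := fun s => ∫ x, Real.sin (s * x) / s ∂ν) (l := 𝓝[≠] 0) ?_ ?_
  · refine tendsto_integral_filter_of_dominated_convergence (fun x => |x|)
      (Eventually.of_forall fun s => by fun_prop) ?_ hi.abs (Eventually.of_forall fun x => ?_)
    · filter_upwards [self_mem_nhdsWithin] with s hs
      have hs0 : s ≠ 0 := hs
      refine Eventually.of_forall fun x => ?_
      rw [Real.norm_eq_abs, abs_div, div_le_iff₀ (by positivity), mul_comm, ← abs_mul]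
      exact Real.abs_sin_le_abs
    · have h : HasDerivAt (fun s => Real.sin (s * x)) x 0 := by
        have := ((hasDerivAt_id (0 : ℝ)).mul_const x).sin
        simpa using this
      refine h.tendsto_slope.congr fun s => ?_
      simp [slope_def_field]
  · refine tendsto_const_nhds.congr' ?_
    filter_upwards [h] with s hs
    rw [integral_div, ← charFun_im_eq_integral_sin, hs, zero_div]

variable {n : ℕ} {a b : Fin n → ℝ}

theorem moments_of_charFun_mul_sinProd (ha : ∀ i, 0 < a i) (hb : ∀ i, 0 < b i)
    (H : ∀ s : ℝ, charFun ν s * sinProd b s = sinProd a s) :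
    MemLp id 2 ν ∧ ∫ x, x ∂ν = 0 ∧ ∫ x, x ^ 2 ∂ν = powerDiff a b 2 / 12 := by
  have h : HasQuadraticExpansion (fun s => (charFun ν s).re) (powerDiff a b 2 / 24) := by
    refine (hasQuadraticExpansion_sinProd_div ha hb).congr ?_
    filter_upwards [charFun_eventually_eq hb H] with s hs
    rw [hs, Complex.ofReal_re]
  have hL := memLp_two_of_charFun_re h
  refine ⟨hL, integral_eq_zero_of_charFun_im hL ?_, ?_⟩
  · filter_upwards [charFun_eventually_eq hb H] with s hs
    rw [hs, Complex.ofReal_im]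
  · rw [integral_sq_of_charFun_re h]
    ring

end Moments

/-! ### Zeros of the sine products, their power sums and Euler's product. -/

section Zeros

/-- The multiplicity of `y` as a positive zero of `sinProd c`. -/
noncomputable def zeroCount {n : ℕ} (c : Fin n → ℝ) (y : ℝ) : ℕ :=
  Nat.card {i // ∃ m : ℕ, c i * y = 2 * Real.pi * (m + 1)}

open Classical in
theorem zeroCount_eq_sum {n : ℕ} (c : Fin n → ℝ) (y : ℝ) :
    (zeroCount c y : ℝ) = ∑ i, if ∃ m : ℕ, c i * y = 2 * Real.pi * (m + 1) then 1 else 0 := by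
  rw [zeroCount, Nat.card_eq_fintype_card, Fintype.card_subtype, Finset.sum_boole]

theorem sin_eq_zero_iff_of_pos {x : ℝ} (hx : 0 < x) :
    Real.sin (x / 2) = 0 ↔ ∃ m : ℕ, x = 2 * Real.pi * (m + 1) := by
  rw [Real.sin_eq_zero_iff]
  constructor
  · rintro ⟨k, hk⟩
    have hk0 : 0 < k := by
      by_contra! h
      have : (k : ℝ) ≤ 0 := by exact_mod_cast h
      nlinarith [Real.pi_pos]
    obtain ⟨m, hm⟩ := Int.eq_ofNat_of_zero_le (show 0 ≤ k - 1 by omega)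
    obtain rfl : k = m + 1 := by omega
    refine ⟨m, ?_⟩
    push_cast at hk
    linarith
  · rintro ⟨m, rfl⟩
    refine ⟨m + 1, ?_⟩
    push_cast
    ring

/-- Each sine factor has only simple zeros, so the order of the product at `y` is the number of
vanishing factors. -/
theorem tendsto_sinProd_div_pow {n : ℕ} {c : Fin n → ℝ} (hc : ∀ i, 0 < c i) {y : ℝ} (hy : 0 < y) :
    ∃ L ≠ 0, Tendsto (fun s => sinProd c s / (s - y) ^ zeroCount c y) (𝓝[≠] y) (𝓝 L) := by
  classical
  have hfac : ∀ i, ∃ l ≠ 0, Tendsto (fun s => Real.sin (c i * s / 2) / c i /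
      (if ∃ m : ℕ, c i * y = 2 * Real.pi * (m + 1) then s - y else 1)) (𝓝[≠] y) (𝓝 l) := by
    intro i
    have hi := sin_eq_zero_iff_of_pos (mul_pos (hc i) hy)
    by_cases h : ∃ m : ℕ, c i * y = 2 * Real.pi * (m + 1)
    · have h0 := hi.2 h
      refine ⟨Real.cos (c i * y / 2) / 2, ?_, ?_⟩
      · intro hcos
        have := Real.sin_sq_add_cos_sq (c i * y / 2)
        rw [h0, (div_eq_zero_iff.1 hcos).resolve_right two_ne_zero] at this
        norm_num at this
      · have hd : HasDerivAt (fun s => Real.sin (c i * s / 2) / c i)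
            (Real.cos (c i * y / 2) / 2) y := by
          have := ((((hasDerivAt_id y).const_mul (c i)).div_const 2).sin).div_const (c i)
          refine this.congr_deriv ?_
          have := (hc i).ne'
          simp only [id]
          field_simp
        refine hd.tendsto_slope.congr fun s => ?_
        rw [if_pos h, slope_def_field, h0, zero_div, sub_zero]
    · refine ⟨Real.sin (c i * y / 2) / c i, div_ne_zero (fun h0 => h (hi.1 h0)) (hc i).ne', ?_⟩
      simp only [if_neg h, div_one]
      have : Continuous fun s => Real.sin (c i * s / 2) / c i := by fun_prop
      exact (this.tendsto y).mono_left nhdsWithin_le_nhds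
  choose l hl0 hl using hfac
  refine ⟨∏ i, l i, Finset.prod_ne_zero_iff.2 fun i _ => hl0 i, ?_⟩
  refine (tendsto_finsetProd Finset.univ fun i _ => hl i).congr fun s => ?_
  rw [Finset.prod_div_distrib, sinProd, zeroCount, Nat.card_eq_fintype_card, Fintype.card_subtype,
    Finset.prod_ite, Finset.prod_const, Finset.prod_const_one, mul_one]

/-- A zero of higher order in `sinProd b` would force `sinProd a`, divided by its own vanishing
order, to tend to `0`. -/
theorem zeroCount_le_of_abs_sinProd_le {n : ℕ} {a b : Fin n → ℝ} (ha : ∀ i, 0 < a i)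
    (hb : ∀ i, 0 < b i) (h : ∀ s, |sinProd a s| ≤ |sinProd b s|) {y : ℝ} (hy : 0 < y) :
    zeroCount b y ≤ zeroCount a y := by
  by_contra! hlt
  obtain ⟨L, hL, hLa⟩ := tendsto_sinProd_div_pow ha hy
  obtain ⟨M, -, hMb⟩ := tendsto_sinProd_div_pow hb hy
  obtain ⟨d, hd⟩ := Nat.exists_eq_add_of_lt hlt
  have h0 : Tendsto (fun s : ℝ => |s - y| ^ (d + 1)) (𝓝[≠] y) (𝓝 0) := by
    have : Continuous fun s : ℝ => |s - y| ^ (d + 1) := by fun_prop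
    simpa using (this.tendsto y).mono_left nhdsWithin_le_nhds
  have h1 := hMb.abs.mul h0
  rw [mul_zero] at h1
  have h2 : |L| ≤ 0 := by
    refine le_of_tendsto_of_tendsto hLa.abs h1 ?_
    filter_upwards [self_mem_nhdsWithin] with s hs
    have hs0 : 0 < |s - y| := abs_pos.2 (sub_ne_zero.2 hs)
    rw [abs_div, abs_div, abs_pow, abs_pow, hd, add_assoc, pow_add, ← div_div, div_mul_cancel₀]
    · exact div_le_div_of_nonneg_right (h s) (by positivity)
    · positivity
  exact hL (abs_nonpos_iff.1 h2)

theorem zeroCount_of_nonpos {n : ℕ} {c : Fin n → ℝ} (hc : ∀ i, 0 < c i) {y : ℝ} (hy : y ≤ 0) :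
    zeroCount c y = 0 := by
  rw [zeroCount, Nat.card_eq_zero]
  left
  refine ⟨fun ⟨i, m, hm⟩ => ?_⟩
  have h1 : c i * y ≤ 0 := mul_nonpos_of_nonneg_of_nonpos (hc i).le hy
  have h2 : 0 < 2 * Real.pi * ((m : ℝ) + 1) := by positivity
  linarith

/-- The index `i` contributes the zeros `2π(m + 1) / c i`; regrouping by value produces the
multiplicity. -/
theorem hasSum_zeroCount_mul {n : ℕ} {c : Fin n → ℝ} (hc : ∀ i, 0 < c i) {h : ℝ → ℝ}
    {v : Fin n → ℝ} (hv : ∀ i, HasSum (fun m : ℕ => h (2 * Real.pi * (m + 1) / c i)) (v i)) :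
    HasSum (fun y => zeroCount c y * h y) (∑ i, v i) := by
  classical
  have hi : ∀ i ∈ Finset.univ, HasSum (fun y : ℝ =>
      (if ∃ m : ℕ, c i * y = 2 * Real.pi * (m + 1) then 1 else 0) * h y) (v i) := by
    intro i _
    have hne := (hc i).ne'
    have hinj : Function.Injective fun m : ℕ => 2 * Real.pi * ((m : ℝ) + 1) / c i := by
      intro m m' hm
      have hpi := Real.pi_ne_zero
      simp only at hm
      field_simp at hm
      exact_mod_cast add_right_cancel hm
    rw [← hinj.hasSum_iff]
    · convert! hv i using 1
      funext m
      simp only [Function.comp]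
      rw [if_pos ⟨m, by field_simp⟩, one_mul]
    · intro y hy
      rw [if_neg, zero_mul]
      rintro ⟨m, hm⟩
      exact hy ⟨m, by simp only; rw [← hm]; field_simp⟩
  have := hasSum_sum hi
  simpa only [← Finset.sum_mul, ← zeroCount_eq_sum] using this

/-- The signed count of the zeros at `y > 0` of `sinProd a / sinProd b`. -/
noncomputable def netZeroCount {n : ℕ} (a b : Fin n → ℝ) (y : ℝ) : ℝ :=
  zeroCount a y - zeroCount b y

variable {n : ℕ} {a b : Fin n → ℝ}

theorem netZeroCount_nonneg (ha : ∀ i, 0 < a i) (hb : ∀ i, 0 < b i)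
    (h : ∀ s, |sinProd a s| ≤ |sinProd b s|) (y : ℝ) : 0 ≤ netZeroCount a b y := by
  rw [netZeroCount, sub_nonneg, Nat.cast_le]
  rcases le_or_gt y 0 with hy | hy
  · rw [zeroCount_of_nonpos hb hy]
    exact Nat.zero_le _
  · exact zeroCount_le_of_abs_sinProd_le ha hb h hy

theorem one_le_netZeroCount (ha : ∀ i, 0 < a i) (hb : ∀ i, 0 < b i)
    (h : ∀ s, |sinProd a s| ≤ |sinProd b s|) {y : ℝ} (hy : netZeroCount a b y ≠ 0) :
    1 ≤ netZeroCount a b y := by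
  have h0 := lt_of_le_of_ne (netZeroCount_nonneg ha hb h y) hy.symm
  rw [netZeroCount, sub_pos, Nat.cast_lt] at h0
  rw [netZeroCount, le_sub_iff_add_le]
  exact_mod_cast (by omega : 1 + zeroCount b y ≤ zeroCount a y)

theorem pos_of_netZeroCount_ne_zero (ha : ∀ i, 0 < a i) (hb : ∀ i, 0 < b i) {y : ℝ}
    (hy : netZeroCount a b y ≠ 0) : 0 < y := by
  by_contra! h
  simp [netZeroCount, zeroCount_of_nonpos ha h, zeroCount_of_nonpos hb h] at hy

theorem hasSum_one_div_zero_pow {c : ℝ} (hc : 0 < c) {k : ℕ} (hk : k ≠ 0) :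
    HasSum (fun m : ℕ => (1 / (2 * Real.pi * (m + 1) / c)) ^ (2 * k))
      ((-1) ^ (k + 1) * bernoulli (2 * k) / (2 * (2 * k).factorial) * c ^ (2 * k)) := by
  have h := (hasSum_nat_add_iff' 1).2 (hasSum_zeta_nat hk)
  have h2 := h.mul_left ((c / (2 * Real.pi)) ^ (2 * k))
  convert! h2 using 1
  · funext m
    rw [one_div_div, one_div, ← inv_pow, ← mul_pow]
    congr 1
    push_cast
    field_simp
  · obtain ⟨j, rfl⟩ := Nat.exists_eq_succ_of_ne_zero hk
    simp only [Finset.sum_range_one, Nat.cast_zero]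
    -- The index-zero term of the zeta series is `1 / 0 = 0`, so the shift by one loses nothing.
    rw [zero_pow (by positivity), div_zero, sub_zero, div_pow, mul_pow,
      show 2 * j.succ - 1 = 2 * j + 1 by omega, show 2 * j.succ = 2 * j + 2 by omega]
    have : (0 : ℝ) < (2 * j + 2).factorial := by positivity
    have hpi := Real.pi_ne_zero
    field_simp
    ring

/-- The zeta-normalized power sums are the power sums of the reciprocals of the zeros. -/
theorem hasSum_netZeroCount_pow (ha : ∀ i, 0 < a i) (hb : ∀ i, 0 < b i) {k : ℕ} (hk : k ≠ 0) :
    HasSum (fun y => netZeroCount a b y * (1 / y) ^ (2 * k))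
      ((-1) ^ (k + 1) * bernoulli (2 * k) / (2 * (2 * k).factorial) * powerDiff a b (2 * k)) := by
  have h := (hasSum_zeroCount_mul ha (h := fun y => (1 / y) ^ (2 * k))
    fun i => hasSum_one_div_zero_pow (ha i) hk).sub
    (hasSum_zeroCount_mul hb (h := fun y => (1 / y) ^ (2 * k))
      fun i => hasSum_one_div_zero_pow (hb i) hk)
  simp only [← sub_mul] at h
  rw [← Finset.mul_sum, ← Finset.mul_sum, ← mul_sub, ← Finset.sum_sub_distrib] at h
  exact h

theorem hasSum_netZeroCount_sq (ha : ∀ i, 0 < a i) (hb : ∀ i, 0 < b i) :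
    HasSum (fun y => netZeroCount a b y * (1 / y) ^ 2) (powerDiff a b 2 / 24) := by
  have h := hasSum_netZeroCount_pow ha hb one_ne_zero
  rw [mul_one, bernoulli_two] at h
  convert! h using 1
  norm_num
  ring

/-- Since `Real.log` is the logarithm of the absolute value, this holds for all nonzero values, even
where some factors are negative. -/
theorem hasSum_log_euler_sin {x : ℝ} (hx : Real.sin (Real.pi * x) ≠ 0) :
    HasSum (fun m : ℕ => Real.log (1 - x ^ 2 / ((m : ℝ) + 1) ^ 2))
      (Real.log (Real.sin (Real.pi * x) / (Real.pi * x))) := by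
  have hx0 : Real.pi * x ≠ 0 := fun h => hx (by rw [h, Real.sin_zero])
  have hs : Summable fun m : ℕ => Real.log (1 - x ^ 2 / ((m : ℝ) + 1) ^ 2) := by
    have h1 : Summable fun m : ℕ => -(x ^ 2 / ((m : ℝ) + 1) ^ 2) := by
      have h := (summable_nat_add_iff 1).2 (Real.summable_one_div_nat_pow.2 one_lt_two)
      refine (h.mul_left (-x ^ 2)).congr fun m => ?_
      push_cast
      ring
    exact (Real.summable_log_one_add_of_summable h1).congr fun m => by rw [← sub_eq_add_neg]
  have hfac : ∀ m : ℕ, 1 - x ^ 2 / ((m : ℝ) + 1) ^ 2 ≠ 0 := by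
    intro m h
    have hm : ((m : ℝ) + 1) ≠ 0 := by positivity
    have h2 : x ^ 2 = ((m : ℝ) + 1) ^ 2 := by
      field_simp at h
      linarith
    apply hx
    rcases sq_eq_sq_iff_eq_or_eq_neg.1 h2 with h3 | h3
    · rw [h3, mul_comm]
      exact_mod_cast Real.sin_nat_mul_pi (m + 1)
    · rw [h3, mul_neg, Real.sin_neg, neg_eq_zero, mul_comm]
      exact_mod_cast Real.sin_nat_mul_pi (m + 1)
  have ht : Tendsto (fun N : ℕ => ∏ j ∈ Finset.range N, (1 - x ^ 2 / ((j : ℝ) + 1) ^ 2)) atTop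
      (𝓝 (Real.sin (Real.pi * x) / (Real.pi * x))) := by
    refine ((Real.tendsto_euler_sin_prod x).div_const (Real.pi * x)).congr fun N => ?_
    rw [mul_div_cancel_left₀ _ hx0]
  have hl := ht.log (div_ne_zero hx hx0)
  refine (hs.hasSum_iff_tendsto_nat).2 (hl.congr fun N => ?_)
  rw [Real.log_prod fun j _ => hfac j]

theorem sin_ne_zero_of_sinProd_ne_zero {c : Fin n → ℝ} {s : ℝ} (h : sinProd c s ≠ 0) (i : Fin n) :
    Real.sin (c i * s / 2) ≠ 0 :=
  (div_ne_zero_iff.1 (Finset.prod_ne_zero_iff.1 h i (Finset.mem_univ i))).1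

/-- The correction `n * log (s / 2)` depends only on the number of factors and cancels between `a`
and `b`. -/
theorem hasSum_zeroCount_mul_log {c : Fin n → ℝ} (hc : ∀ i, 0 < c i) {s : ℝ} (hs : s ≠ 0)
    (h : sinProd c s ≠ 0) :
    HasSum (fun y => zeroCount c y * Real.log (1 - (s / y) ^ 2))
      (Real.log (sinProd c s) - n * Real.log (s / 2)) := by
  have h1 := hasSum_zeroCount_mul hc (h := fun y => Real.log (1 - (s / y) ^ 2))
    (v := fun i => Real.log (Real.sin (c i * s / 2) / (c i * s / 2))) ?_
  · convert! h1 using 1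
    have hi : ∀ i, Real.log (Real.sin (c i * s / 2) / (c i * s / 2)) =
        Real.log (Real.sin (c i * s / 2) / c i) - Real.log (s / 2) := by
      intro i
      rw [← Real.log_div (div_ne_zero (sin_ne_zero_of_sinProd_ne_zero h i) (hc i).ne')
        (div_ne_zero hs two_ne_zero), div_div, mul_div_assoc]
    simp only [hi, Finset.sum_sub_distrib, Finset.sum_const, Finset.card_univ, Fintype.card_fin,
      nsmul_eq_mul]
    rw [sinProd, Real.log_prod]
    exact fun i _ => div_ne_zero (sin_ne_zero_of_sinProd_ne_zero h i) (hc i).ne'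
  · intro i
    have hpi := Real.pi_ne_zero
    have hx : Real.pi * (c i * s / (2 * Real.pi)) = c i * s / 2 := by field_simp
    have h2 := hasSum_log_euler_sin (x := c i * s / (2 * Real.pi))
      (by rw [hx]; exact sin_ne_zero_of_sinProd_ne_zero h i)
    rw [hx] at h2
    convert! h2 using 1
    funext m
    rw [← div_pow]
    congr 3
    have := (hc i).ne'
    field_simp

theorem hasSum_netZeroCount_log (ha : ∀ i, 0 < a i) (hb : ∀ i, 0 < b i) {s : ℝ} (hs : s ≠ 0)
    (hsa : sinProd a s ≠ 0) (hsb : sinProd b s ≠ 0) :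
    HasSum (fun y => netZeroCount a b y * Real.log (1 - (s / y) ^ 2))
      (Real.log (sinProd a s / sinProd b s)) := by
  have h := (hasSum_zeroCount_mul_log ha hs hsa).sub (hasSum_zeroCount_mul_log hb hs hsb)
  simp only [← sub_mul, sub_sub_sub_cancel_right] at h
  rw [Real.log_div hsa hsb]
  exact h

end Zeros

/-! ### Two-sided bounds for the characteristic function below its zeros. -/

section Bounds

theorem log_one_sub_le {u : ℝ} (h0 : 0 ≤ u) (h1 : u < 1) : Real.log (1 - u) ≤ -u - u ^ 2 / 2 := by
  have h := sum_le_hasSum (Finset.range 2) (fun i _ => by positivity)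
    (Real.hasSum_pow_div_log_of_abs_lt_one (by rwa [abs_of_nonneg h0] : |u| < 1))
  simp only [Finset.sum_range_succ, Finset.sum_range_zero] at h
  norm_num at h
  linarith

theorem le_log_one_sub {u : ℝ} (h1 : u ≤ 1 / 2) :
    -u - 2 * u ^ 2 ≤ Real.log (1 - u) := by
  have h := Real.one_sub_inv_le_log_of_pos (by linarith : 0 < 1 - u)
  refine le_trans ?_ h
  have hu : 0 < 1 - u := by linarith
  rw [← sub_nonneg]
  have : 1 - (1 - u)⁻¹ - (-u - 2 * u ^ 2) = u ^ 2 * (1 - 2 * u) / (1 - u) := by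
    field_simp
    ring
  rw [this]
  exact div_nonneg (mul_nonneg (sq_nonneg u) (by linarith)) hu.le

variable {n : ℕ} {a b : Fin n → ℝ}

theorem countable_sinProd_eq_zero {c : Fin n → ℝ} (hc : ∀ i, 0 < c i) :
    {s | sinProd c s = 0}.Countable := by
  have : {s | sinProd c s = 0} ⊆
      ⋃ i, Set.range fun k : ℤ => 2 * (k * Real.pi) / c i := by
    intro s hs
    obtain ⟨i, -, hi⟩ := Finset.prod_eq_zero_iff.1 hs
    have hne := (hc i).ne'
    obtain ⟨k, hk⟩ := Real.sin_eq_zero_iff.1 ((div_eq_zero_iff.1 hi).resolve_right hne)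
    refine Set.mem_iUnion.2 ⟨i, k, ?_⟩
    simp only [hk]
    field_simp
  exact (Set.countable_iUnion fun i => Set.countable_range _).mono this

/-- Identities and bounds obtained by division or logarithms extend to all relevant `s` by
continuity. -/
theorem dense_sinProd_ne_zero (ha : ∀ i, 0 < a i) (hb : ∀ i, 0 < b i) :
    Dense {s | sinProd a s ≠ 0 ∧ sinProd b s ≠ 0} := by
  have h := ((countable_sinProd_eq_zero ha).union (countable_sinProd_eq_zero hb)).dense_compl ℝ
  convert h using 1
  ext s
  simp

/-- The sum of the fourth powers of the reciprocals of the zeros. -/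
noncomputable def zeroQuarticSum (a b : Fin n → ℝ) : ℝ :=
  ∑' y, netZeroCount a b y * (1 / y) ^ 4

theorem hasSum_zeroQuarticSum (ha : ∀ i, 0 < a i) (hb : ∀ i, 0 < b i) :
    HasSum (fun y => netZeroCount a b y * (1 / y) ^ 4) (zeroQuarticSum a b) :=
  (hasSum_netZeroCount_pow ha hb two_ne_zero).summable.hasSum

theorem log_sinProd_div_le (ha : ∀ i, 0 < a i) (hb : ∀ i, 0 < b i)
    (h : ∀ s, |sinProd a s| ≤ |sinProd b s|) {s : ℝ} (hs : 0 < s)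
    (hy : ∀ y, netZeroCount a b y ≠ 0 → s < y) (hsa : sinProd a s ≠ 0) (hsb : sinProd b s ≠ 0) :
    Real.log (sinProd a s / sinProd b s) ≤
      -(s ^ 2 * (powerDiff a b 2 / 24)) - s ^ 4 / 2 * zeroQuarticSum a b := by
  refine hasSum_le (fun y => ?_) (hasSum_netZeroCount_log ha hb hs.ne' hsa hsb)
    (((hasSum_netZeroCount_sq ha hb).mul_left (s ^ 2)).neg.sub
      ((hasSum_zeroQuarticSum ha hb).mul_left (s ^ 4 / 2)))
  by_cases h0 : netZeroCount a b y = 0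
  · simp [h0]
  · have hsy := hy y h0
    have hy0 : 0 < y := hs.trans hsy
    have hl := log_one_sub_le (u := (s / y) ^ 2) (sq_nonneg _)
      (by rw [div_pow, div_lt_one (by positivity)]; gcongr)
    calc _ ≤ netZeroCount a b y * (-(s / y) ^ 2 - ((s / y) ^ 2) ^ 2 / 2) :=
          mul_le_mul_of_nonneg_left hl (netZeroCount_nonneg ha hb h y)
      _ = _ := by ring

theorem le_log_sinProd_div (ha : ∀ i, 0 < a i) (hb : ∀ i, 0 < b i)
    (h : ∀ s, |sinProd a s| ≤ |sinProd b s|) {s : ℝ} (hs : 0 < s)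
    (hy : ∀ y, netZeroCount a b y ≠ 0 → 2 * s ≤ y) (hsa : sinProd a s ≠ 0)
    (hsb : sinProd b s ≠ 0) :
    -(s ^ 2 * (powerDiff a b 2 / 24)) - 2 * s ^ 4 * zeroQuarticSum a b ≤
      Real.log (sinProd a s / sinProd b s) := by
  refine hasSum_le (fun y => ?_)
    (((hasSum_netZeroCount_sq ha hb).mul_left (s ^ 2)).neg.sub
      ((hasSum_zeroQuarticSum ha hb).mul_left (2 * s ^ 4)))
    (hasSum_netZeroCount_log ha hb hs.ne' hsa hsb)
  by_cases h0 : netZeroCount a b y = 0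
  · simp [h0]
  · have hsy := hy y h0
    have hy0 : 0 < y := by linarith
    have hl := le_log_one_sub (u := (s / y) ^ 2)
      (by rw [div_pow, div_le_iff₀ (by positivity)]; nlinarith)
    calc _ = netZeroCount a b y * (-(s / y) ^ 2 - 2 * ((s / y) ^ 2) ^ 2) := by ring
      _ ≤ _ := mul_le_mul_of_nonneg_left hl (netZeroCount_nonneg ha hb h y)

theorem charFun_re_eq_sinProd_div {ν : Measure ℝ}
    (H : ∀ s : ℝ, charFun ν s * sinProd b s = sinProd a s) {s : ℝ}
    (hs : sinProd b s ≠ 0) : (charFun ν s).re = sinProd a s / sinProd b s := by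
  have h2 : charFun ν s = ((sinProd a s / sinProd b s : ℝ) : ℂ) := by
    rw [Complex.ofReal_div, ← H, mul_div_cancel_right₀]
    exact_mod_cast hs
  rw [h2, Complex.ofReal_re]

variable {ν : Measure ℝ} [IsProbabilityMeasure ν]

theorem abs_sinProd_le (H : ∀ s : ℝ, charFun ν s * sinProd b s = sinProd a s) (s : ℝ) :
    |sinProd a s| ≤ |sinProd b s| := by
  have h := congrArg norm (H s)
  rw [norm_mul, Complex.norm_real, Complex.norm_real] at h
  rw [← Real.norm_eq_abs, ← h]
  exact mul_le_of_le_one_left (norm_nonneg _) (norm_charFun_le_one s)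

theorem charFun_eq_ofReal_re (ha : ∀ i, 0 < a i) (hb : ∀ i, 0 < b i)
    (H : ∀ s : ℝ, charFun ν s * sinProd b s = sinProd a s) (s : ℝ) :
    charFun ν s = ((charFun ν s).re : ℂ) := by
  have h : (fun s => charFun ν s) = fun s => ((charFun ν s).re : ℂ) := by
    refine Continuous.ext_on (dense_sinProd_ne_zero ha hb) continuous_charFun
      (Complex.continuous_ofReal.comp (Complex.continuous_re.comp continuous_charFun)) ?_
    rintro s ⟨-, hs⟩
    have h2 : charFun ν s = ((sinProd a s / sinProd b s : ℝ) : ℂ) := by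
      rw [Complex.ofReal_div, ← H, mul_div_cancel_right₀]
      exact_mod_cast hs
    simp only [h2, Complex.ofReal_re]
  exact congrFun h s

theorem abs_charFun_re_le (ha : ∀ i, 0 < a i) (hb : ∀ i, 0 < b i)
    (H : ∀ s : ℝ, charFun ν s * sinProd b s = sinProd a s) {s : ℝ} (hs : 0 < s)
    (hy : ∀ y, netZeroCount a b y ≠ 0 → 2 * s ≤ y) :
    |(charFun ν s).re| ≤
      Real.exp (-(s ^ 2 * (powerDiff a b 2 / 24)) - s ^ 4 / 2 * zeroQuarticSum a b) := by
  -- The factor `2` in `hy` keeps a whole neighbourhood `(0, 2s)` of `s` below the zeros, so `s` can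
  -- be approached by good points.
  have hmem := (dense_sinProd_ne_zero ha hb).open_subset_closure_inter
    (isOpen_Ioo (a := 0) (b := 2 * s)) (show s ∈ Set.Ioo 0 (2 * s) from ⟨hs, by linarith⟩)
  refine le_on_closure (f := fun s => |(charFun ν s).re|) (g := fun s =>
    Real.exp (-(s ^ 2 * (powerDiff a b 2 / 24)) - s ^ 4 / 2 * zeroQuarticSum a b))
    ?_ ?_ (by fun_prop) hmem
  · rintro x ⟨⟨hx0, hx⟩, hxa, hxb⟩
    rw [charFun_re_eq_sinProd_div H hxb, ← Real.exp_log (abs_pos.2 (div_ne_zero hxa hxb)), Real.log_abs,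
      Real.exp_le_exp]
    exact log_sinProd_div_le ha hb (abs_sinProd_le H) hx0 (fun y h => hx.trans_le (hy y h)) hxa hxb
  · exact ((Complex.continuous_re.comp continuous_charFun).abs).continuousOn

theorem le_abs_charFun_re (ha : ∀ i, 0 < a i) (hb : ∀ i, 0 < b i)
    (H : ∀ s : ℝ, charFun ν s * sinProd b s = sinProd a s) {s : ℝ} (hs : 0 < s)
    (hy : ∀ y, netZeroCount a b y ≠ 0 → 4 * s ≤ y) :
    Real.exp (-(s ^ 2 * (powerDiff a b 2 / 24)) - 2 * s ^ 4 * zeroQuarticSum a b) ≤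
      |(charFun ν s).re| := by
  have hmem := (dense_sinProd_ne_zero ha hb).open_subset_closure_inter
    (isOpen_Ioo (a := 0) (b := 2 * s)) (show s ∈ Set.Ioo 0 (2 * s) from ⟨hs, by linarith⟩)
  refine le_on_closure (g := fun s => |(charFun ν s).re|) (f := fun s =>
    Real.exp (-(s ^ 2 * (powerDiff a b 2 / 24)) - 2 * s ^ 4 * zeroQuarticSum a b))
    ?_ (by fun_prop) ?_ hmem
  · rintro x ⟨⟨hx0, hx⟩, hxa, hxb⟩
    rw [charFun_re_eq_sinProd_div H hxb, ← Real.exp_log (abs_pos.2 (div_ne_zero hxa hxb)), Real.log_abs,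
      Real.exp_le_exp]
    exact le_log_sinProd_div ha hb (abs_sinProd_le H) hx0
      (fun y h => by linarith [hy y h]) hxa hxb
  · exact ((Complex.continuous_re.comp continuous_charFun).abs).continuousOn

/-- The real part is `1` at `0` and cannot cross `0`, because the exponential lower bound keeps its
absolute value positive. -/
theorem charFun_re_pos (ha : ∀ i, 0 < a i) (hb : ∀ i, 0 < b i)
    (H : ∀ s : ℝ, charFun ν s * sinProd b s = sinProd a s) {s : ℝ} (hs : 0 < s)
    (hy : ∀ y, netZeroCount a b y ≠ 0 → 4 * s ≤ y) : 0 < (charFun ν s).re := by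
  by_contra! hneg
  have h0 : (charFun ν 0).re = 1 := by simp
  obtain ⟨x, ⟨hx0, hxs⟩, hx⟩ := intermediate_value_Icc' hs.le
    (Complex.continuous_re.comp (continuous_charFun (μ := ν))).continuousOn
    (show (0 : ℝ) ∈ Set.Icc (charFun ν s).re (charFun ν 0).re from ⟨hneg, by rw [h0]; norm_num⟩)
  simp only [Function.comp] at hx
  rcases hx0.eq_or_lt with rfl | hx0
  · rw [h0] at hx
    norm_num at hx
  · have := le_abs_charFun_re ha hb H hx0 (fun y h => by linarith [hy y h])
    rw [hx, abs_zero] at this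
    exact absurd this (not_le.2 (Real.exp_pos _))

end Bounds

/-! ### Bernoulli terms as power sums of reciprocal zeros. -/

section PowerSums

variable {n : ℕ} {a b : Fin n → ℝ}

theorem powerDiff_two_nonneg (ha : ∀ i, 0 < a i) (hb : ∀ i, 0 < b i)
    (h : ∀ s, |sinProd a s| ≤ |sinProd b s|) : 0 ≤ powerDiff a b 2 := by
  have := (hasSum_netZeroCount_sq ha hb).nonneg
    fun y => mul_nonneg (netZeroCount_nonneg ha hb h y) (sq_nonneg _)
  linarith

/-- A single term of a nonnegative sum, whose integer multiplicity is at least `1`. -/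
theorem one_div_pow_le_of_netZeroCount_ne_zero (ha : ∀ i, 0 < a i) (hb : ∀ i, 0 < b i)
    (h : ∀ s, |sinProd a s| ≤ |sinProd b s|) {k : ℕ} {S : ℝ}
    (hS : HasSum (fun y => netZeroCount a b y * (1 / y) ^ (2 * k)) S) {y : ℝ}
    (hy : netZeroCount a b y ≠ 0) : (1 / y) ^ (2 * k) ≤ S := by
  have hnn (y : ℝ) : 0 ≤ (1 / y) ^ (2 * k) := by rw [pow_mul]; positivity
  refine le_trans ?_ (le_hasSum hS y
    fun x _ => mul_nonneg (netZeroCount_nonneg ha hb h x) (hnn x))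
  exact le_mul_of_one_le_left (hnn y) (one_le_netZeroCount ha hb h hy)

/-- Split off `(1 / y)²`, which sums to `D / 24`; each remaining factor `(1 / y)²` is at most `D /
T²`. -/
theorem le_of_hasSum_netZeroCount_pow (ha : ∀ i, 0 < a i) (hb : ∀ i, 0 < b i)
    (h : ∀ s, |sinProd a s| ≤ |sinProd b s|) {k : ℕ} {S : ℝ}
    (hS : HasSum (fun y => netZeroCount a b y * (1 / y) ^ (2 * (k + 1))) S) {T : ℝ} (hT : 0 < T)
    (hy : ∀ y, netZeroCount a b y ≠ 0 → T ≤ y * √(powerDiff a b 2)) :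
    S ≤ powerDiff a b 2 / 24 * (powerDiff a b 2 / T ^ 2) ^ k := by
  have hD := powerDiff_two_nonneg ha hb h
  refine hasSum_le (fun y => ?_) hS ((hasSum_netZeroCount_sq ha hb).mul_right _)
  by_cases h0 : netZeroCount a b y = 0
  · simp [h0]
  · have hpos := pos_of_netZeroCount_ne_zero ha hb h0
    have hTy := hy y h0
    rw [mul_add, pow_add, mul_comm ((1 / y) ^ (2 * k)), mul_one, ← mul_assoc, pow_mul]
    refine mul_le_mul_of_nonneg_left (pow_le_pow_left₀ (by positivity) ?_ k)
      (mul_nonneg (netZeroCount_nonneg ha hb h y) (sq_nonneg _))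
    rw [div_pow, one_pow, div_le_div_iff₀ (by positivity) (by positivity), one_mul]
    calc T ^ 2 ≤ (y * √(powerDiff a b 2)) ^ 2 := by gcongr
      _ = _ := by rw [mul_pow, Real.sq_sqrt hD, mul_comm]

theorem exists_hasSum_bernoulliTerm_eq (ha : ∀ i, 0 < a i) (hb : ∀ i, 0 < b i) {k : ℕ}
    (hk : k ≠ 0) : ∃ S, HasSum (fun y => netZeroCount a b y * (1 / y) ^ (2 * k)) S ∧
      ∀ t, bernoulliTerm a b t k = (-1) ^ (k + 1) * (t ^ (2 * k) / k * (S / powerDiff a b 2 ^ k)) := by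
  refine ⟨_, hasSum_netZeroCount_pow ha hb hk, fun t => ?_⟩
  have hs : ((-1 : ℝ) ^ (k + 1)) * (-1) ^ (k + 1) = 1 := by
    rw [← mul_pow]; simp
  have hk0 : (k : ℝ) ≠ 0 := by exact_mod_cast hk
  have hf : ((2 * k).factorial : ℝ) ≠ 0 := by positivity
  rw [bernoulliTerm]
  generalize (-1 : ℝ) ^ (k + 1) = e at hs ⊢
  calc _ = (e * e) * ((bernoulli (2 * k) : ℝ) * (t ^ (2 * k) / ((2 * k : ℝ) * ((2 * k).factorial : ℝ)))
    * (powerDiff a b (2 * k) / powerDiff a b 2 ^ k)) := by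
        rw [hs, one_mul]
    _ = _ := by field_simp

theorem abs_bernoulliTerm (ha : ∀ i, 0 < a i) (hb : ∀ i, 0 < b i)
    (h : ∀ s, |sinProd a s| ≤ |sinProd b s|) {k : ℕ} {S : ℝ}
    (hk : k ≠ 0) (hS : HasSum (fun y => netZeroCount a b y * (1 / y) ^ (2 * k)) S) (t : ℝ) :
    |bernoulliTerm a b t k| = t ^ (2 * k) / k * (S / powerDiff a b 2 ^ k) := by
  obtain ⟨S', hS', ht⟩ := exists_hasSum_bernoulliTerm_eq ha hb hk
  obtain rfl := hS.unique hS'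
  have hS0 : 0 ≤ S := hS.nonneg fun y => mul_nonneg (netZeroCount_nonneg ha hb h y)
    (by rw [pow_mul]; positivity)
  have hD := powerDiff_two_nonneg ha hb h
  rw [ht, abs_mul, abs_pow, abs_neg, abs_one, one_pow, one_mul, abs_of_nonneg]
  rw [pow_mul]
  positivity

theorem abs_bernoulliTerm_le (ha : ∀ i, 0 < a i) (hb : ∀ i, 0 < b i)
    (h : ∀ s, |sinProd a s| ≤ |sinProd b s|) (hD : powerDiff a b 2 ≠ 0) {T R t : ℝ} (hT : 0 < T)
    (hy : ∀ y, netZeroCount a b y ≠ 0 → T ≤ y * √(powerDiff a b 2)) (ht : |t| ≤ R) (k : ℕ) :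
    |bernoulliTerm a b t (k + 2)| ≤ R ^ 2 / 24 * (R ^ 2 / T ^ 2) ^ (k + 1) := by
  have hD0 := lt_of_le_of_ne (powerDiff_two_nonneg ha hb h) hD.symm
  obtain ⟨S, hS, -⟩ := exists_hasSum_bernoulliTerm_eq ha hb (k := k + 2) (by omega)
  have hle := le_of_hasSum_netZeroCount_pow ha hb h (k := k + 1) hS hT hy
  rw [abs_bernoulliTerm ha hb h (by omega) hS]
  have h1 : t ^ (2 * (k + 2)) ≤ R ^ (2 * (k + 2)) := by
    rw [pow_mul, pow_mul, ← sq_abs]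
    gcongr
  have h2 : t ^ (2 * (k + 2)) / ((k + 2 : ℕ) : ℝ) ≤ R ^ (2 * (k + 2)) := by
    refine (div_le_self (by rw [pow_mul]; positivity) ?_).trans h1
    push_cast
    linarith [(Nat.cast_nonneg k : (0 : ℝ) ≤ k)]
  calc _ ≤ R ^ (2 * (k + 2)) * ((powerDiff a b 2 / 24 * (powerDiff a b 2 / T ^ 2) ^ (k + 1)) /
        powerDiff a b 2 ^ (k + 2)) := by
        gcongr
        · refine div_nonneg (hS.nonneg fun y => mul_nonneg (netZeroCount_nonneg ha hb h y) ?_)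
            (by positivity)
          rw [pow_mul]; positivity
        · rw [pow_mul]; positivity
    _ = _ := by
        rw [div_pow, div_pow]
        field_simp
        ring

/-- A zero with `y √D < T` alone makes the terms at least `r ^ k / k` in absolute value with `r >
1`, so they cannot tend to `0`. -/
theorem le_mul_sqrt_of_summable (ha : ∀ i, 0 < a i) (hb : ∀ i, 0 < b i)
    (h : ∀ s, |sinProd a s| ≤ |sinProd b s|) (hD : powerDiff a b 2 ≠ 0) {T : ℝ} (hT : 0 < T)
    (hs : Summable fun k => bernoulliTerm a b T (k + 2)) {y : ℝ} (hy : netZeroCount a b y ≠ 0) :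
    T ≤ y * √(powerDiff a b 2) := by
  by_contra! hlt
  have hD0 := lt_of_le_of_ne (powerDiff_two_nonneg ha hb h) hD.symm
  have hpos := pos_of_netZeroCount_ne_zero ha hb hy
  set r := T ^ 2 / (y ^ 2 * powerDiff a b 2) with hr
  have hr1 : 1 < r := by
    rw [hr, one_lt_div (by positivity)]
    calc _ = (y * √(powerDiff a b 2)) ^ 2 := by rw [mul_pow, Real.sq_sqrt hD0.le]
      _ < _ := by gcongr
  have hterm : ∀ k : ℕ, r ^ (k + 2) / ((k + 2 : ℕ) : ℝ) ≤ |bernoulliTerm a b T (k + 2)| := by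
    intro k
    obtain ⟨S, hS, -⟩ := exists_hasSum_bernoulliTerm_eq ha hb (k := k + 2) (by omega)
    rw [abs_bernoulliTerm ha hb h (by omega) hS]
    have hle := one_div_pow_le_of_netZeroCount_ne_zero ha hb h hS hy
    calc _ = T ^ (2 * (k + 2)) / ((k + 2 : ℕ) : ℝ) *
          ((1 / y) ^ (2 * (k + 2)) / powerDiff a b 2 ^ (k + 2)) := by
          rw [hr, pow_mul, pow_mul, div_pow, div_pow, mul_pow]
          field_simp
          rw [← mul_pow, mul_one_div_cancel (by positivity), one_pow]
      _ ≤ _ := by gcongr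
  have h1 : Tendsto (fun k : ℕ => r ^ (k + 2) / ((k + 2 : ℕ) : ℝ)) atTop (𝓝 0) :=
    squeeze_zero (fun k => by positivity) hterm (by simpa using hs.tendsto_atTop_zero.abs)
  have h2 := (tendsto_pow_const_div_const_pow_of_one_lt 1 hr1).comp (tendsto_add_atTop_nat 2)
  have h3 := h1.mul h2
  rw [mul_zero] at h3
  refine zero_ne_one (tendsto_nhds_unique (h3.congr fun k => ?_)
    (tendsto_const_nhds (x := (1 : ℝ))))
  have : r ≠ 0 := by positivity
  simp only [Function.comp, pow_one]
  field_simp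

end PowerSums

/-! ### Both limit conditions and the escape of zeros. -/

section Sequences

/-- The zeros of the characteristic functions, normalized by the standard deviations, escape to
infinity. -/
def ZerosEscape (a b : (n : ℕ) → Fin n → ℝ) : Prop :=
  (∀ᶠ n in atTop, powerDiff (a n) (b n) 2 ≠ 0) ∧
  ∀ T : ℝ, ∀ᶠ n in atTop, ∀ y, netZeroCount (a n) (b n) y ≠ 0 → T ≤ y * √(powerDiff (a n) (b n) 2)

variable {a b : (n : ℕ) → Fin n → ℝ}

/-- Convergence of the series at the one point `max T 1` already pushes the zeros past `T`;
conversely the terms are dominated by a geometric series with small sum. -/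
theorem bernoulliSeriesTendstoZero_iff_zerosEscape (ha : ∀ n i, 0 < a n i)
    (hb : ∀ n i, 0 < b n i) (h : ∀ n s, |sinProd (a n) s| ≤ |sinProd (b n) s|) :
    BernoulliSeriesTendstoZero a b ↔ ZerosEscape a b := by
  constructor
  · rintro ⟨h1, h2⟩
    refine ⟨h1, fun T => ?_⟩
    filter_upwards [h1, (h2 {max T 1} Bornology.isBounded_singleton).1] with n hD hs y hy
    exact (le_max_left _ _).trans (le_mul_sqrt_of_summable (ha n) (hb n) (h n) hD (by positivity)
      (hs _ rfl) hy)
  · rintro ⟨h1, h2⟩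
    refine ⟨h1, fun A hA => ?_⟩
    obtain ⟨R, hR0, hR⟩ := hA.exists_pos_norm_le
    have main : ∀ ε > 0, ∀ᶠ n in atTop, ∀ t ∈ A,
        (Summable fun k : ℕ => bernoulliTerm (a n) (b n) t (k + 2)) ∧
        |∑' k : ℕ, bernoulliTerm (a n) (b n) t (k + 2)| < ε := by
      intro ε hε
      -- `x ≥ 2` bounds the ratio `1 / x²` by `1 / (2x) ≤ 1 / 4`, and `x > R² / ε` makes the
      -- geometric sum less than `ε`.
      set x := 2 + R ^ 2 / ε with hx
      have hx2 : 2 ≤ x := by rw [hx]; linarith [(by positivity : 0 ≤ R ^ 2 / ε)]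
      filter_upwards [h1, h2 (R * x)] with n hD hy t ht
      have hT : 0 < R * x := by positivity
      have hb' := abs_bernoulliTerm_le (ha n) (hb n) (h n) hD hT hy (hR t ht)
      have hq : R ^ 2 / (R * x) ^ 2 = 1 / x ^ 2 := by field_simp
      rw [hq] at hb'
      have hq1 : 1 / x ^ 2 ≤ 1 / (2 * x) := by
        gcongr
        nlinarith
      have hq2 : 1 / (2 * x) ≤ 1 / 4 := by
        gcongr
        linarith
      have hg : HasSum (fun k : ℕ => R ^ 2 / 24 * (1 / x ^ 2) ^ (k + 1))
          (R ^ 2 / 24 * ((1 - 1 / x ^ 2)⁻¹ * (1 / x ^ 2))) := by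
        simp only [pow_succ (1 / x ^ 2)]
        exact ((hasSum_geometric_of_lt_one (by positivity) (by linarith)).mul_right _).mul_left _
      refine ⟨Summable.of_norm_bounded hg.summable hb', ?_⟩
      refine (tsum_of_norm_bounded
        (f := fun k => bernoulliTerm (a n) (b n) t (k + 2)) hg hb').trans_lt ?_
      have h3 : (1 - 1 / x ^ 2)⁻¹ ≤ 2 := by
        rw [inv_le_comm₀ (by linarith) two_pos]
        linarith
      have h4 : R ^ 2 / ε < x := by rw [hx]; linarith
      rw [div_lt_iff₀ hε] at h4
      calc R ^ 2 / 24 * ((1 - 1 / x ^ 2)⁻¹ * (1 / x ^ 2)) ≤ R ^ 2 / 24 * (2 * (1 / (2 * x))) := by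
            gcongr
        _ = R ^ 2 / x / 24 := by field_simp
        _ ≤ R ^ 2 / x := div_le_self (by positivity) (by norm_num)
        _ < ε := by rw [div_lt_iff₀ (by positivity)]; linarith
    refine ⟨(main 1 one_pos).mono fun n hn t ht => (hn t ht).1, ?_⟩
    rw [Metric.tendstoUniformlyOn_iff]
    intro ε hε
    filter_upwards [main ε hε] with n hn t ht
    rw [dist_comm, Real.dist_eq, sub_zero]
    exact (hn t ht).2

variable {ν : ℕ → Measure ℝ} [∀ n, IsProbabilityMeasure (ν n)]

/-- The argument `t = 1/2` lies safely below every normalized zero, so the upper bound applies with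
no prior control on the zeros; a zero that stays bounded then keeps the value strictly below `exp
(-1/8)`. -/
theorem zerosEscape_of_tendsto_charFun (ha : ∀ n i, 0 < a n i) (hb : ∀ n i, 0 < b n i)
    (H : ∀ n (s : ℝ), charFun (ν n) s * sinProd (b n) s = sinProd (a n) s)
    (hlim : Tendsto (fun n => (charFun (ν n) ((1 / 2) / √(powerDiff (a n) (b n) 2 / 12))).re) atTop
      (𝓝 (Real.exp (-(1 / 8))))) : ZerosEscape a b := by
  have h1 : ∀ᶠ n in atTop, powerDiff (a n) (b n) 2 ≠ 0 := by
    have : Real.exp (-(1 / 8)) < 1 := Real.exp_lt_one_iff.2 (by norm_num)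
    filter_upwards [hlim.eventually_lt_const this] with n hn h0
    -- With zero variance, division by `√0` gives argument `0`, where the characteristic function is
    -- `1`.
    simp [h0] at hn
  refine ⟨h1, fun T' => ?_⟩
  set T := max T' 1
  have hT : 0 < T := by positivity
  -- The gap is `s⁴ / (2 y⁴)` at `y √D = T`, using `s² = 3 / D`.
  have hlt : Real.exp (-(1 / 8) - 9 / 2 / T ^ 4) < Real.exp (-(1 / 8)) :=
    Real.exp_lt_exp.2 (by linarith [(by positivity : 0 < 9 / 2 / T ^ 4)])
  filter_upwards [h1, hlim.eventually_const_lt hlt] with n hD hn y hy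
  refine (le_max_left T' 1).trans ?_
  by_contra! hyT
  have h := abs_sinProd_le (H n)
  have hD0 := lt_of_le_of_ne (powerDiff_two_nonneg (ha n) (hb n) h) hD.symm
  set D := powerDiff (a n) (b n) 2 with hDdef
  set s := (1 / 2) / √(D / 12) with hs
  have hs0 : 0 < s := by positivity
  have hs2 : s ^ 2 = 3 / D := by
    rw [hs, div_pow, Real.sq_sqrt (by positivity)]
    field_simp
    norm_num
  -- Every zero has `1 / y² ≤ D / 24`, so `y² ≥ 24 / D`, while `(2s)² = 12 / D`.
  have hsy : ∀ y, netZeroCount (a n) (b n) y ≠ 0 → 2 * s ≤ y := by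
    intro y hy
    have hpos := pos_of_netZeroCount_ne_zero (ha n) (hb n) hy
    have := one_div_pow_le_of_netZeroCount_ne_zero (ha n) (hb n) h (k := 1)
      (by simpa using hasSum_netZeroCount_sq (ha n) (hb n)) hy
    rw [← hDdef, mul_one, div_pow, one_pow, div_le_div_iff₀ (by positivity) (by norm_num)] at this
    refine le_of_sq_le_sq ?_ hpos.le
    rw [mul_pow, hs2, ← mul_div_assoc, div_le_iff₀ hD0]
    nlinarith
  have hpos := pos_of_netZeroCount_ne_zero (ha n) (hb n) hy
  have hup := (le_abs_self _).trans (abs_charFun_re_le (ha n) (hb n) (H n) hs0 hsy)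
  have h4 := one_div_pow_le_of_netZeroCount_ne_zero (ha n) (hb n) h (k := 2)
    (hasSum_zeroQuarticSum (ha n) (hb n)) hy
  have hlt2 := Real.exp_lt_exp.1 (hn.trans_le hup)
  rw [hs2] at hlt2
  have h5 : 3 / D * (D / 24) = 1 / 8 := by field_simp; norm_num
  have h6 : s ^ 4 = 9 / D ^ 2 := by
    rw [show s ^ 4 = (s ^ 2) ^ 2 by ring, hs2]
    ring
  have h7 : (y * √D) ^ 4 = y ^ 4 * D ^ 2 := by
    rw [mul_pow, show √D ^ 4 = (√D ^ 2) ^ 2 by ring, Real.sq_sqrt hD0.le]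
  have h8 : y ^ 4 * D ^ 2 ≤ T ^ 4 := by
    rw [← h7]
    gcongr
  have h9 : 9 / 2 / T ^ 4 ≤ s ^ 4 / 2 * zeroQuarticSum (a n) (b n) := by
    calc 9 / 2 / T ^ 4 ≤ 9 / 2 / (y ^ 4 * D ^ 2) := by gcongr
      _ = s ^ 4 / 2 * (1 / y) ^ (2 * 2) := by
        rw [h6, div_pow, one_pow, show 2 * 2 = 4 from rfl]
        field_simp
      _ ≤ _ := by gcongr
  rw [h5] at hlt2
  linarith

theorem charFun_re_neg {ν : Measure ℝ} [IsProbabilityMeasure ν] (s : ℝ) :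
    (charFun ν (-s)).re = (charFun ν s).re := by
  simp only [charFun_re_eq_integral_cos, neg_mul, Real.cos_neg]

theorem tendsto_charFun_of_zerosEscape (ha : ∀ n i, 0 < a n i) (hb : ∀ n i, 0 < b n i)
    (H : ∀ n (s : ℝ), charFun (ν n) s * sinProd (b n) s = sinProd (a n) s)
    (hz : ZerosEscape a b) (t : ℝ) :
    Tendsto (fun n => (charFun (ν n) (t / √(powerDiff (a n) (b n) 2 / 12))).re) atTop
      (𝓝 (Real.exp (-t ^ 2 / 2))) := by
  wlog ht : 0 < t generalizing t
  · rcases (not_lt.1 ht).eq_or_lt with rfl | ht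
    · simp
    · have := this (-t) (by linarith)
      simpa only [neg_div, charFun_re_neg, neg_sq] using this
  -- Here `s² = 12 t² / D`, so `4s ≤ y` needs `192 t² ≤ y² D`, and `16² = 256` suffices. The error
  -- is `2 s⁴ Q` with `Q ≤ D² / (24 T²)`, that is, at most `12 t⁴ / T²`.
  have key : ∀ T, 16 * t ≤ T → ∀ᶠ n in atTop,
      Real.exp (-t ^ 2 / 2 - 12 * t ^ 4 / T ^ 2) ≤
        (charFun (ν n) (t / √(powerDiff (a n) (b n) 2 / 12))).re ∧
      (charFun (ν n) (t / √(powerDiff (a n) (b n) 2 / 12))).re ≤ Real.exp (-t ^ 2 / 2) := by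
    intro T htT
    have hT : 0 < T := by linarith
    filter_upwards [hz.1, hz.2 T] with n hD hy
    have h := abs_sinProd_le (H n)
    have hD0 := lt_of_le_of_ne (powerDiff_two_nonneg (ha n) (hb n) h) hD.symm
    have hQ := le_of_hasSum_netZeroCount_pow (ha n) (hb n) h (k := 1)
      (hasSum_zeroQuarticSum (ha n) (hb n)) hT hy
    have hQ0 : 0 ≤ zeroQuarticSum (a n) (b n) := (hasSum_zeroQuarticSum (ha n) (hb n)).nonneg
      fun y => mul_nonneg (netZeroCount_nonneg (ha n) (hb n) h y) (by positivity)
    set s := t / √(powerDiff (a n) (b n) 2 / 12) with hs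
    have hs0 : 0 < s := by positivity
    have hs2 : s ^ 2 = 12 * t ^ 2 / powerDiff (a n) (b n) 2 := by
      rw [hs, div_pow, Real.sq_sqrt (by positivity)]
      field_simp
    have hsy : ∀ y, netZeroCount (a n) (b n) y ≠ 0 → 4 * s ≤ y := by
      intro y h0
      have hpos := pos_of_netZeroCount_ne_zero (ha n) (hb n) h0
      have h3 := hy y h0
      have h4 : (16 * t) ^ 2 ≤ (y * √(powerDiff (a n) (b n) 2)) ^ 2 := by
        have := htT.trans h3
        gcongr
      rw [mul_pow y, Real.sq_sqrt hD0.le] at h4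
      refine le_of_sq_le_sq ?_ hpos.le
      rw [mul_pow, hs2, ← mul_div_assoc, div_le_iff₀ hD0]
      nlinarith [sq_nonneg t]
    have hup := abs_charFun_re_le (ha n) (hb n) (H n) hs0 (fun y h0 => by linarith [hsy y h0])
    have hlo := le_abs_charFun_re (ha n) (hb n) (H n) hs0 hsy
    have hre := charFun_re_pos (ha n) (hb n) (H n) hs0 hsy
    rw [abs_of_pos hre] at hup hlo
    have h5 : s ^ 2 * (powerDiff (a n) (b n) 2 / 24) = t ^ 2 / 2 := by
      rw [hs2]
      field_simp
      norm_num
    have h6 : 2 * s ^ 4 * zeroQuarticSum (a n) (b n) ≤ 12 * t ^ 4 / T ^ 2 := by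
      calc _ ≤ 2 * s ^ 4 * _ := mul_le_mul_of_nonneg_left hQ (by positivity)
        _ = _ := by
          rw [show s ^ 4 = (s ^ 2) ^ 2 by ring, hs2]
          field_simp
          norm_num
    have h7 : 0 ≤ s ^ 4 / 2 * zeroQuarticSum (a n) (b n) := by positivity
    rw [h5] at hup hlo
    refine ⟨le_trans (Real.exp_le_exp.2 ?_) hlo, hup.trans (Real.exp_le_exp.2 ?_)⟩ <;> linarith
  rw [tendsto_order]
  refine ⟨fun c hc => ?_, fun c hc => ?_⟩
  -- Choose `T` large first, then let `n → ∞`.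
  · have hcont : Tendsto (fun T : ℝ => Real.exp (-t ^ 2 / 2 - 12 * t ^ 4 / T ^ 2)) atTop
        (𝓝 (Real.exp (-t ^ 2 / 2))) := by
      have h1 : Tendsto (fun T : ℝ => 12 * t ^ 4 / T ^ 2) atTop (𝓝 0) :=
        tendsto_const_nhds.div_atTop (tendsto_pow_atTop two_ne_zero)
      have h2 := (h1.const_sub (-t ^ 2 / 2)).rexp
      rwa [sub_zero] at h2
    obtain ⟨T, hT, hT2⟩ := ((hcont.eventually_const_lt hc).and (eventually_ge_atTop (16 * t))).exists
    exact (key T hT2).mono fun n hn => hT.trans_le hn.1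
  · exact (key (16 * t) le_rfl).mono fun n hn => hn.2.trans_lt hc

end Sequences

/-! ### Mean, variance, Lévy's continuity theorem and conclusion. -/

theorem mean_and_variance {n : ℕ} {a b : Fin n → ℝ} (ha : ∀ i, 0 < a i) (hb : ∀ i, 0 < b i)
    {Ω : Type*} [MeasurableSpace Ω] {P : Measure Ω} [IsProbabilityMeasure P] {ξ : Ω → ℝ}
    (hξ : AEMeasurable ξ P) {m : ℝ}
    (H : ∀ s : ℝ, charFun (P.map fun ω => ξ ω - m) s * sinProd b s = sinProd a s) :
    MemLp ξ 2 P ∧ ∫ ω, ξ ω ∂P = m ∧ variance ξ P = powerDiff a b 2 / 12 := by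
  have hη : AEMeasurable (fun ω => ξ ω - m) P := hξ.sub_const m
  have : IsProbabilityMeasure (P.map fun ω => ξ ω - m) := Measure.isProbabilityMeasure_map hη
  obtain ⟨h1, h2, h3⟩ := moments_of_charFun_mul_sinProd ha hb H
  rw [memLp_map_measure_iff (by fun_prop) hη] at h1
  rw [integral_map hη (by fun_prop)] at h2 h3
  have hL : MemLp ξ 2 P := by
    convert! h1.add (memLp_const m) using 1
    funext ω
    simp
  have hm : ∫ ω, ξ ω ∂P = m := by
    rw [integral_sub (hL.integrable one_le_two) (integrable_const _)] at h2
    simp only [integral_const, probReal_univ, one_smul] at h2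
    linarith
  refine ⟨hL, hm, ?_⟩
  rw [variance_eq_integral hξ, hm, h3]

/-- Lévy's continuity theorem, with the division by the standard deviation moved into the argument.
-/
theorem asymptoticallyNormal_iff_tendsto_charFun {Ω : ℕ → Type*} [∀ n, MeasurableSpace (Ω n)]
    {P : (n : ℕ) → Measure (Ω n)} [∀ n, IsProbabilityMeasure (P n)]
    {ξ : (n : ℕ) → Ω n → ℝ} (hξ : ∀ n, AEMeasurable (ξ n) (P n)) :
    AsymptoticallyNormal P ξ ↔ ∀ t : ℝ, Tendsto (fun n =>
      charFun ((P n).map fun ω => ξ n ω - ∫ ω', ξ n ω' ∂(P n)) (t / √(variance (ξ n) (P n)))) atTop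
      (𝓝 (Real.exp (-t ^ 2 / 2) : ℝ)) := by
  have hmeas : ∀ n, AEMeasurable
      (fun ω => (ξ n ω - ∫ ω', ξ n ω' ∂(P n)) / √(variance (ξ n) (P n))) (P n) :=
    fun n => ((hξ n).sub_const _).div_const _
  have hg : ∀ t, charFun ((gaussianReal 0 1).map id) t = (Real.exp (-t ^ 2 / 2) : ℝ) := by
    intro t
    rw [Measure.map_id, charFun_gaussianReal]
    push_cast
    congr 1
    simp
    ring
  have hc : ∀ t n, charFun
      ((P n).map (fun ω => (ξ n ω - ∫ ω', ξ n ω' ∂(P n)) / √(variance (ξ n) (P n)))) t =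
      charFun ((P n).map fun ω => ξ n ω - ∫ ω', ξ n ω' ∂(P n)) (t / √(variance (ξ n) (P n))) := by
    intro t n
    rw [charFun_apply_real, charFun_apply_real, integral_map (hmeas n) (by fun_prop),
      integral_map ((hξ n).sub_const _) (by fun_prop)]
    refine integral_congr_ae (Eventually.of_forall fun ω => ?_)
    simp only
    push_cast
    ring_nf
  have hlevy : AsymptoticallyNormal P ξ ↔ ∀ t : ℝ, Tendsto (fun n => charFun
      ((P n).map (fun ω => (ξ n ω - ∫ ω', ξ n ω' ∂(P n)) / √(variance (ξ n) (P n)))) t) atTop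
      (𝓝 (charFun ((gaussianReal 0 1).map id) t)) :=
    ⟨fun h => ProbabilityMeasure.tendsto_iff_tendsto_charFun.1 h.tendsto,
      fun h => ⟨hmeas, aemeasurable_id, ProbabilityMeasure.tendsto_iff_tendsto_charFun.2 h⟩⟩
  simp only [hlevy, hg, hc]

theorem theorem2
    (a b : (n : ℕ) → Fin n → ℝ)
    (ha : ∀ n i, 0 < a n i) (hb : ∀ n i, 0 < b n i)
    (hnonneg : ∀ (n : ℕ) (k : ℝ), 0 ≤ qCoeff (a n) (b n) k)
    {Ω : ℕ → Type*} [∀ n, MeasurableSpace (Ω n)]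
    (P : (n : ℕ) → Measure (Ω n)) [∀ n, IsProbabilityMeasure (P n)]
    (ξ : (n : ℕ) → Ω n → ℝ) (hξ : ∀ n, AEMeasurable (ξ n) (P n))
    (hlaw : ∀ (n : ℕ) (k : ℝ),
      (P n).real {ω | ξ n ω = k} = qCoeff (a n) (b n) k / ∑' j : ℝ, qCoeff (a n) (b n) j) :
    (∀ n, MemLp (ξ n) 2 (P n) ∧
      variance (ξ n) (P n) = (1 / 12) * ∑ i, (a n i ^ 2 - b n i ^ 2)) ∧
    (AsymptoticallyNormal P ξ ↔ BernoulliSeriesTendstoZero a b) := by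
  have H := fun n => charFun_mul_sinProd (ha n) (hb n) (hnonneg n) (hξ n) (hlaw n)
  have hmv := fun n => mean_and_variance (ha n) (hb n) (hξ n) (H n)
  refine ⟨fun n => ⟨(hmv n).1, ?_⟩, ?_⟩
  · rw [(hmv n).2.2, powerDiff]
    ring
  · set ν : ℕ → Measure ℝ := fun n => (P n).map fun ω => ξ n ω - (∑ i, (a n i - b n i)) / 2 with hν
    have : ∀ n, IsProbabilityMeasure (ν n) :=
      fun n => Measure.isProbabilityMeasure_map ((hξ n).sub_const _)
    rw [asymptoticallyNormal_iff_tendsto_charFun hξ, bernoulliSeriesTendstoZero_iff_zerosEscape ha hb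
      fun n => abs_sinProd_le (ν := ν n) (H n)]
    simp only [(hmv _).2.1, (hmv _).2.2]
    constructor
    · intro h
      refine zerosEscape_of_tendsto_charFun (ν := ν) ha hb H ?_
      have h1 := (Complex.continuous_re.tendsto _).comp (h (1 / 2))
      rw [Complex.ofReal_re, show -(1 / 2 : ℝ) ^ 2 / 2 = -(1 / 8) by norm_num] at h1
      exact h1
    · intro h t
      have h1 := (Complex.continuous_ofReal.tendsto _).comp
        (tendsto_charFun_of_zerosEscape (ν := ν) ha hb H h t)
      refine h1.congr fun n => ?_
      exact (charFun_eq_ofReal_re (ν := ν n) (ha n) (hb n) (H n) _).symm
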